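/- Let $k$ be a field of characteristic $0$ and let $\mathcal C$ be a tensor category over $k$: a rigid symmetric monoidal abelian category with $\otimes$ $k$-bilinear and $\mathrm{End}(\mathbf 1)=k$. Assume that the rank $\mathrm{rk}(X)\in\mathrm{End}(\mathbf 1)$ (the trace of $\mathrm{id}_X$) of every object $X$ is a natural number, and let $K$ be an extension field of $k$. Let $T_{\mathcal C}$ be the following many-sorted first-order theory. It has a sort $V_X$ for every object $X$, with $L=V_{\mathbf 1}$; function symbols $+_X:V_X\times V_X\to V_X$ and $\cdot_X:L\times V_X\to V_X$ for every $X$, $v_f:V_X\to V_Y$ for every morphism $f:X\to Y$, and $b_{X,Y}:V_X\times V_Y\to V_{X\otimes Y}$ for all $X,Y$; and a constant of sort $L$ for every element of $K$. The axioms say: 1. $(L,+_{\mathbf 1},\cdot_{\mathbf 1})$ is an algebraically closed field, whose operations on the constants (including zero and one) are those of $K$; 2. $+_X$ and $\cdot_X$ make $V_X$ a vector space over $L$ of dimension $\mathrm{rk}(X)$, and each $v_f$ is $L$-linear; 3. $v_{\mathrm{id}_X}=\mathrm{id}$, $v_{f\circ g}=v_f\circ v_g$, $v_{f+g}=v_f+v_g$,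 $v_{a\cdot\mathrm{id}_X}$ is multiplication by $a\in k\subseteq K$, $v_f=0$ if and only if $f=0$, and $v_f$ is injective (surjective) if and only if $f$ is a monomorphism (an epimorphism); 4. $b_{X,Y}$ is $L$-bilinear, the induced map $V_X\otimes_L V_Y\to V_{X\otimes Y}$ is an isomorphism, and $b$ is compatible with the commutativity and associativity constraints of $\mathcal C$ through the maps $v$. Then: (a) $T_{\mathcal C}$ is stable: for no formula $\varphi(x;y)$ are there a model $M$ of $T_{\mathcal C}$ and tuples $a_i,b_j$ ($i,j\in\mathbb N$) in $M$ such that $M\models\varphi(a_i;b_j)$ if and only if $i<j$. (b) $L$ is stably embedded: for every formula $\varphi(x,y)$ with $y$ a tuple of $n$ variables of sort $L$ (and $x$ a tuple of variables of any sorts) there is a formula $\psi(w,y)$ in the language of rings such that, in each model of $T_{\mathcal C}$ and for each $x$, there is a tuple $w$ in $L$ with $\{y\in L^n:\varphi(x,y)\}=\{y\in L^n:\psi(w,y)\}$. (c) In each model $M$ of $T_{\mathcal C}$, $L$ is a pure algebraically closed field, possibly with additional constants: $L(M)$ is an algebraically closed field (of characteristic $0$), and there is a subset $A\subseteq L(M)$,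 containing the constants from $K$, such that for every $n$ the subsets of $L(M)^n$ that are definable in $M$ without parameters are precisely those that are definable in the field $L(M)$ with constants for the elements of $A$. -/

import Mathlib

open CategoryTheory MonoidalCategory

universe v u r w

noncomputable section

namespace TensorTheory

/-! ## The rank of an object of a rigid symmetric monoidal category -/

section Rank

variable {C : Type u} [Category.{v} C] [MonoidalCategory C] [SymmetricCategory C]
  [RigidCategory C]

/-- The rank of `X`: the trace of the identity of `X`, an element of `End(𝟙)`. -/
def rank (X : C) : 𝟙_ C ⟶ 𝟙_ C :=
  η_ X (Xᘁ) ≫ (β_ X (Xᘁ)).hom ≫ ε_ X (Xᘁ)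

end Rank

section HasRank

variable {C : Type u} [Category.{v} C] [Preadditive C] [MonoidalCategory C]
  [SymmetricCategory C] [RigidCategory C]

/-- The rank of `X` is the natural number `n`. -/
def HasRank (X : C) (n : ℕ) : Prop := rank X = n • 𝟙 (𝟙_ C)

end HasRank

/-! ## The many-sorted language

The sorts are the objects of `C`; the sort of `X` is the sort `V_X`.  The sort `L` is the sort of
the unit object `𝟙_ C`, so that `+_𝟙` and `·_𝟙` are binary operations on `L`. -/

section Language

variable (C : Type u) [Category.{v} C] [MonoidalCategory C] (K : Type r)

/-- Terms, indexed by their sort.  For each sort `X` there are variables `var X 0, var X 1, …` -/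
inductive Term : C → Type (max u v r)
  /-- the `n`-th variable of the sort `V_X` -/
  | var (X : C) (n : ℕ) : Term X
  /-- the constant symbols, of sort `L` -/
  | const (a : K) : Term (𝟙_ C)
  /-- the function symbols `v_f : V_X → V_Y` -/
  | map {X Y : C} (f : X ⟶ Y) (t : Term X) : Term Y
  /-- the function symbols `+_X : V_X × V_X → V_X` -/
  | add {X : C} (s t : Term X) : Term X
  /-- the function symbols `·_X : L × V_X → V_X` -/
  | smul {X : C} (a : Term (𝟙_ C)) (t : Term X) : Term X
  /-- the function symbols `b_{X,Y} : V_X × V_Y → V_{X ⊗ Y}` -/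
  | tensor {X Y : C} (s : Term X) (t : Term Y) : Term (X ⊗ Y)

/-- First-order formulas of the language. -/
inductive Formula : Type (max u v r)
  | falsum : Formula
  | equal {X : C} (s t : Term C K X) : Formula
  | imp (φ ψ : Formula) : Formula
  /-- universal quantification over the `n`-th variable of the sort `V_X` -/
  | all (X : C) (n : ℕ) (φ : Formula) : Formula

/-- Structures for the language.  As usual, all sorts are non-empty. -/
structure Struct where
  /-- the interpretation of the sort `V_X` -/
  carrier : C → Type w
  nonempty : ∀ X, Nonempty (carrier X)
  const : K → carrier (𝟙_ C)
  map : ∀ {X Y : C}, (X ⟶ Y) → carrier X → carrier Y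
  add : ∀ {X : C}, carrier X → carrier X → carrier X
  smul : ∀ {X : C}, carrier (𝟙_ C) → carrier X → carrier X
  tensor : ∀ {X Y : C}, carrier X → carrier Y → carrier (X ⊗ Y)

end Language

section Semantics

variable {C : Type u} [Category.{v} C] [MonoidalCategory C] {K : Type r}

/-- Assignments of elements of `M` to all variables of all sorts. -/
abbrev Struct.Assignment (M : Struct.{v, u, r, w} C K) : Type (max u w) :=
  ∀ X : C, ℕ → M.carrier X

open Classical in
/-- The assignment that gives the value `a` to the `n`-th variable of the sort `V_X`, and agrees
with `v` on all other variables. -/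
def Struct.Assignment.update {M : Struct.{v, u, r, w} C K} (v : M.Assignment) (X : C) (n : ℕ)
    (a : M.carrier X) : M.Assignment :=
  Function.update v X (Function.update (v X) n a)

/-- The value of a term. -/
def Term.value (M : Struct.{v, u, r, w} C K) (v : M.Assignment) :
    ∀ {X : C}, Term C K X → M.carrier X
  | _, .var X n => v X n
  | _, .const a => M.const a
  | _, .map f t => M.map f (t.value M v)
  | _, .add s t => M.add (s.value M v) (t.value M v)
  | _, .smul a t => M.smul (a.value M v) (t.value M v)
  | _, .tensor s t => M.tensor (s.value M v) (t.value M v)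

/-- Satisfaction of a formula in `M` under an assignment. -/
def Formula.Realize (M : Struct.{v, u, r, w} C K) : Formula C K → M.Assignment → Prop
  | .falsum, _ => False
  | .equal s t, v => s.value M v = t.value M v
  | .imp φ ψ, v => φ.Realize M v → ψ.Realize M v
  | .all X n φ, v => ∀ a : M.carrier X, φ.Realize M (v.update X n a)

/-- `M` is a model of the set of axioms `T`.  Free variables of an axiom are understood to be
universally quantified. -/
def Struct.Models (M : Struct.{v, u, r, w} C K) (T : Set (Formula C K)) : Prop :=
  ∀ φ ∈ T, ∀ v : M.Assignment, φ.Realize M v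

end Semantics

/-! ## Abbreviations for terms and formulas -/

section Abbreviations

variable {C : Type u} [Category.{v} C] [MonoidalCategory C] {K : Type r}

notation:65 s:65 " +ᵗ " t:66 => Term.add s t

notation:73 a:74 " •ᵗ " t:73 => Term.smul a t

namespace Formula

/-- negation -/
def neg (φ : Formula C K) : Formula C K := φ.imp falsum

/-- truth -/
def verum : Formula C K := neg falsum

/-- conjunction -/
def and (φ ψ : Formula C K) : Formula C K := neg (φ.imp (neg ψ))

/-- existential quantification -/
def ex (X : C) (n : ℕ) (φ : Formula C K) : Formula C K := neg (all X n (neg φ))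

/-- universal quantification over the variables `N, …, N + n - 1` of the sort `V_X` -/
def allBlock (X : C) (N : ℕ) : ℕ → Formula C K → Formula C K
  | 0, φ => φ
  | n + 1, φ => allBlock X N n (all X (N + n) φ)

/-- existential quantification over the variables `N, …, N + n - 1` of the sort `V_X` -/
def exBlock (X : C) (N : ℕ) : ℕ → Formula C K → Formula C K
  | 0, φ => φ
  | n + 1, φ => exBlock X N n (ex X (N + n) φ)

/-- finite conjunction -/
def conj (l : List (Formula C K)) : Formula C K := l.foldr and verum

end Formula

variable [Field K]

/-- The zero vector of `V_X`, as `0 · x` (in a vector space this is independent of `x`). -/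
def Term.zero (X : C) : Term C K X := Term.const 0 •ᵗ Term.var X 0

/-- The term `a₀ · t₀ + (a₁ · t₁ + (… + 0))`. -/
def Term.lincomb {X : C} {n : ℕ} (a : Fin n → Term C K (𝟙_ C)) (t : Fin n → Term C K X) :
    Term C K X :=
  (List.ofFn fun i => a i •ᵗ t i).foldr Term.add (Term.zero X)

/-- Powers of a term of sort `L`. -/
def Term.pow (t : Term C K (𝟙_ C)) : ℕ → Term C K (𝟙_ C)
  | 0 => Term.const 1
  | n + 1 => t •ᵗ Term.pow t n

open Formula

/-- The formula saying that `t₀, …, tₙ₋₁` is a basis of `V_X` over `L`: the terms span `V_X`, and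
they are linearly independent.  All variables in the terms should have an index below `N`. -/
def basisFormula {X : C} (N : ℕ) {n : ℕ} (t : Fin n → Term C K X) : Formula C K :=
  and
    (all X (N + n) (exBlock (𝟙_ C) N n
      (equal (Term.var X (N + n)) (Term.lincomb (fun i => Term.var (𝟙_ C) (N + i)) t))))
    (allBlock (𝟙_ C) N n
      (imp (equal (Term.lincomb (fun i => Term.var (𝟙_ C) (N + i)) t) (Term.zero X))
        (conj (List.ofFn fun i : Fin n => equal (Term.var (𝟙_ C) (N + i)) (Term.const 0)))))

/-- The sentence saying that `V_X` has dimension `n` over `L`. -/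
def dimFormula (X : C) (n : ℕ) : Formula C K :=
  exBlock X 0 n (basisFormula n fun i : Fin n => Term.var X i)

/-- For `V_X` of dimension `n` and `V_Y` of dimension `m`, and given that `b_{X,Y}` is bilinear,
the sentence saying that the induced linear map from the tensor product of `V_X` and `V_Y` over `L`
to `V_{X ⊗ Y}` is an isomorphism: there are a basis `x₀, …, xₙ₋₁` of `V_X` and a basis
`y₀, …, yₘ₋₁` of `V_Y` such that the `b_{X,Y}(xᵢ, yⱼ)` form a basis of `V_{X ⊗ Y}`. -/
def tensorIsoFormula (X Y : C) (n m : ℕ) : Formula C K :=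
  let x : Fin n → Term C K X := fun i => Term.var X i
  let y : Fin m → Term C K Y := fun j => Term.var Y (n + j)
  exBlock X 0 n (exBlock Y n m
    (and (basisFormula (n + m) x)
      (and (basisFormula (n + m) y)
        (basisFormula (n + m) fun p : Fin (n * m) =>
          Term.tensor (x (finProdFinEquiv.symm p).1) (y (finProdFinEquiv.symm p).2)))))

/-- Every monic polynomial of degree `n` has a root in `L`. -/
def rootFormula (n : ℕ) : Formula C K :=
  let x : Term C K (𝟙_ C) := Term.var (𝟙_ C) n
  ex (𝟙_ C) n (equal
    (x.pow n +ᵗ Term.lincomb (fun i : Fin n => Term.var (𝟙_ C) i) (fun i => x.pow i))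
    (Term.const 0))

end Abbreviations

/-! ## The theory of a tensor category -/

section Theory

variable (k : Type*) [Field k] (C : Type u) [Category.{v} C] [Abelian C] [MonoidalCategory C]
  [SymmetricCategory C] [RigidCategory C] [Linear k C] (K : Type r) [Field K] [Algebra k K]

open Term Formula

/-- The axioms of `T_C`.  Scalar variables are `var (𝟙_ C) n` with `n ≥ 3`, and variables in `V_X`,
`V_Y`, `V_Z` have indices at most `2`, so that distinct letters below are distinct variables also
when `X`, `Y`, `Z`, `𝟙_ C` are not distinct. -/
inductive IsAxiom : Formula C K → Prop
  -- `V_X` is an abelian group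
  | add_assoc (X : C) :
      IsAxiom (equal (var X 0 +ᵗ var X 1 +ᵗ var X 2) (var X 0 +ᵗ (var X 1 +ᵗ var X 2)))
  | add_comm (X : C) : IsAxiom (equal (var X 0 +ᵗ var X 1) (var X 1 +ᵗ var X 0))
  | add_zero (X : C) : IsAxiom (equal (var X 1 +ᵗ zero X) (var X 1))
  | add_neg (X : C) : IsAxiom (ex X 2 (equal (var X 1 +ᵗ var X 2) (zero X)))
  -- scalar multiplication
  | smul_add (X : C) : IsAxiom (equal (var (𝟙_ C) 3 •ᵗ (var X 0 +ᵗ var X 1))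
      (var (𝟙_ C) 3 •ᵗ var X 0 +ᵗ var (𝟙_ C) 3 •ᵗ var X 1))
  | add_smul (X : C) : IsAxiom (equal ((var (𝟙_ C) 3 +ᵗ var (𝟙_ C) 4) •ᵗ var X 0)
      (var (𝟙_ C) 3 •ᵗ var X 0 +ᵗ var (𝟙_ C) 4 •ᵗ var X 0))
  | mul_smul (X : C) : IsAxiom (equal ((var (𝟙_ C) 3 •ᵗ var (𝟙_ C) 4) •ᵗ var X 0)
      (var (𝟙_ C) 3 •ᵗ (var (𝟙_ C) 4 •ᵗ var X 0)))
  | one_smul (X : C) : IsAxiom (equal (const 1 •ᵗ var X 0) (var X 0))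
  -- together with the axioms above for `X = 𝟙_ C`: `L` is a field
  | L_add_zero : IsAxiom (equal (var (𝟙_ C) 3 +ᵗ const 0) (var (𝟙_ C) 3))
  | L_mul_comm : IsAxiom
      (equal (var (𝟙_ C) 3 •ᵗ var (𝟙_ C) 4) (var (𝟙_ C) 4 •ᵗ var (𝟙_ C) 3))
  | L_zero_ne_one : IsAxiom (neg (equal (const 0) (const 1)))
  | L_inv : IsAxiom (imp (neg (equal (var (𝟙_ C) 3) (const 0)))
      (ex (𝟙_ C) 4 (equal (var (𝟙_ C) 3 •ᵗ var (𝟙_ C) 4) (const 1))))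
  -- `L` is algebraically closed
  | L_root (n : ℕ) (hn : 0 < n) : IsAxiom (rootFormula n)
  -- the field operations on the constants are those of `K`
  | const_add (a b : K) : IsAxiom (equal (const a +ᵗ const b) (const (a + b)))
  | const_mul (a b : K) : IsAxiom
      (equal (const a •ᵗ const b) (const (a * b)))
  -- the dimension of `V_X` is the rank of `X`
  | dim (X : C) (n : ℕ) (hn : HasRank X n) : IsAxiom (dimFormula X n)
  -- the maps `v_f` are linear
  | map_add {X Y : C} (f : X ⟶ Y) :
      IsAxiom (equal (map f (var X 0 +ᵗ var X 1)) (map f (var X 0) +ᵗ map f (var X 1)))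
  | map_smul {X Y : C} (f : X ⟶ Y) :
      IsAxiom (equal (map f (var (𝟙_ C) 3 •ᵗ var X 0)) (var (𝟙_ C) 3 •ᵗ map f (var X 0)))
  -- the `k`-linear category structure
  | map_id (X : C) : IsAxiom (equal (map (𝟙 X) (var X 0)) (var X 0))
  | map_comp {X Y Z : C} (f : X ⟶ Y) (g : Y ⟶ Z) :
      IsAxiom (equal (map (f ≫ g) (var X 0)) (map g (map f (var X 0))))
  | map_scalar (X : C) (a : k) : IsAxiom (equal (map (a • 𝟙 X) (var X 0))
      (const (algebraMap k K a) •ᵗ var X 0))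
  | add_map {X Y : C} (f g : X ⟶ Y) :
      IsAxiom (equal (map (f + g) (var X 0)) (map f (var X 0) +ᵗ map g (var X 0)))
  -- `v_f = 0` if and only if `f = 0`
  | map_eq_zero {X Y : C} (f : X ⟶ Y) (hf : f = 0) :
      IsAxiom (equal (map f (var X 0)) (zero Y))
  | map_ne_zero {X Y : C} (f : X ⟶ Y) (hf : f ≠ 0) :
      IsAxiom (ex X 1 (neg (equal (map f (var X 1)) (zero Y))))
  -- `v_f` is injective, or surjective, if and only if `f` is
  | map_inj {X Y : C} (f : X ⟶ Y) (hf : Mono f) :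
      IsAxiom (imp (equal (map f (var X 0)) (map f (var X 1))) (equal (var X 0) (var X 1)))
  | map_not_inj {X Y : C} (f : X ⟶ Y) (hf : ¬ Mono f) :
      IsAxiom (ex X 0 (ex X 1 (and (equal (map f (var X 0)) (map f (var X 1)))
        (neg (equal (var X 0) (var X 1))))))
  | map_surj {X Y : C} (f : X ⟶ Y) (hf : Epi f) :
      IsAxiom (ex X 0 (equal (map f (var X 0)) (var Y 1)))
  | map_not_surj {X Y : C} (f : X ⟶ Y) (hf : ¬ Epi f) :
      IsAxiom (ex Y 1 (all X 0 (neg (equal (map f (var X 0)) (var Y 1)))))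
  -- `b_{X,Y}` is bilinear
  | tensor_add_left (X Y : C) : IsAxiom (equal (tensor (var X 0 +ᵗ var X 1) (var Y 2))
      (tensor (var X 0) (var Y 2) +ᵗ tensor (var X 1) (var Y 2)))
  | tensor_add_right (X Y : C) : IsAxiom (equal (tensor (var X 0) (var Y 1 +ᵗ var Y 2))
      (tensor (var X 0) (var Y 1) +ᵗ tensor (var X 0) (var Y 2)))
  | tensor_smul_left (X Y : C) : IsAxiom (equal (tensor (var (𝟙_ C) 3 •ᵗ var X 0) (var Y 1))
      (var (𝟙_ C) 3 •ᵗ tensor (var X 0) (var Y 1)))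
  | tensor_smul_right (X Y : C) : IsAxiom (equal (tensor (var X 0) (var (𝟙_ C) 3 •ᵗ var Y 1))
      (var (𝟙_ C) 3 •ᵗ tensor (var X 0) (var Y 1)))
  -- the linear map induced by `b_{X,Y}` on the tensor product is an isomorphism
  | tensor_iso (X Y : C) (n m : ℕ) (hn : HasRank X n) (hm : HasRank Y m) :
      IsAxiom (tensorIsoFormula X Y n m)
  -- compatibility with the commutativity and associativity constraints
  | braiding (X Y : C) : IsAxiom (equal (map (β_ X Y).hom (tensor (var X 0) (var Y 1)))
      (tensor (var Y 1) (var X 0)))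
  | associator (X Y Z : C) :
      IsAxiom (equal (map (α_ X Y Z).hom (tensor (tensor (var X 0) (var Y 1)) (var Z 2)))
        (tensor (var X 0) (tensor (var Y 1) (var Z 2))))

/-- The theory `T_C` associated with the tensor category `C` over `k` and the extension `K`. -/
def theory : Set (Formula C K) := {φ | IsAxiom k C K φ}

end Theory

/-! ## Stability -/

section Stability

variable {C : Type u} [Category.{v} C] [MonoidalCategory C] {K : Type r}

open Classical in
/-- The assignment that agrees with `a` on the set `P` of variables, and with `b` outside `P`. -/
def Struct.Assignment.merge {M : Struct.{v, u, r, w} C K} (P : Set (C × ℕ))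
    (a b : M.Assignment) : M.Assignment :=
  fun X n => if (X, n) ∈ P then a X n else b X n

/-- The theory `T` is stable: no formula `φ(x; y)` has the order property, that is, there are no
model `M` of `T` and tuples `aᵢ`, `bⱼ` (`i, j ∈ ℕ`) in `M` such that `φ(aᵢ; bⱼ)` holds if and only
if `i < j`.  The partition of the variables of `φ` into `x` and `y` is given by the set `P` of the
variables in `x`. -/
def Stable (T : Set (Formula C K)) : Prop :=
  ∀ M : Struct.{v, u, r, w} C K, M.Models T →
    ∀ (φ : Formula C K) (P : Set (C × ℕ)) (a b : ℕ → M.Assignment),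
      ¬ ∀ i j : ℕ, φ.Realize M (Struct.Assignment.merge P (a i) (b j)) ↔ i < j

end Stability

/-! ## The field `L` -/

section TheField

variable {C : Type u} [Category.{v} C] [MonoidalCategory C] {K : Type r} [Field K]

/-- The interpretation of the sort `L`. -/
def Struct.L (M : Struct.{v, u, r, w} C K) : Type w := M.carrier (𝟙_ C)

/-- The structure on `L` in the language of rings: addition and multiplication are `+_𝟙` and `·_𝟙`,
zero and one are the constants for `0` and `1`, and the opposite is multiplication by the constant
for `-1`. -/
instance Struct.ringStructure (M : Struct.{v, u, r, w} C K) :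
    FirstOrder.Language.ring.Structure M.L where
  funMap := fun f x => match f, x with
    | .add, x => M.add (x 0) (x 1)
    | .mul, x => M.smul (x 0) (x 1)
    | .neg, x => M.smul (M.const (-1)) (x 0)
    | .zero, _ => M.const 0
    | .one, _ => M.const 1
  RelMap := fun f => nomatch f

open Classical in
/-- The assignment that gives the values `y 0, …, y (n - 1)` to the first `n` variables of the sort
`L`, and agrees with `v` on all other variables. -/
def Struct.Assignment.setL {M : Struct.{v, u, r, w} C K} (v : M.Assignment) {n : ℕ}
    (y : Fin n → M.L) : M.Assignment :=
  Function.update v (𝟙_ C) fun i => if h : i < n then y ⟨i, h⟩ else v (𝟙_ C) i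

/-- The sort `L`, viewed as a structure in the language of rings, is stably embedded in `T`: for
every formula `φ(x, y)`, where `y = (y₀, …, yₙ₋₁)` are variables of the sort `L` and `x` are all the
other variables of `φ` (of any sorts), there is a formula `ψ(w, y)` in the language of rings such
that in each model of `T`, each set of the form `φ(x, L)` is equal to `ψ(w, L)` for some tuple `w`
in `L`. -/
def StablyEmbedded (T : Set (Formula C K)) : Prop :=
  ∀ (φ : Formula C K) (n : ℕ),
    ∃ (m : ℕ) (ψ : FirstOrder.Language.ring.Formula (Fin m ⊕ Fin n)),
      ∀ M : Struct.{v, u, r, w} C K, M.Models T → ∀ x : M.Assignment,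
        ∃ w : Fin m → M.L, ∀ y : Fin n → M.L,
          φ.Realize M (x.setL y) ↔ ψ.Realize (Sum.elim w y)

/-- `S ⊆ Lⁿ` is definable in `M` without parameters: it is defined by a formula that does not
depend on variables other than the first `n` variables of the sort `L`. -/
def Struct.DefinableL (M : Struct.{v, u, r, w} C K) {n : ℕ} (S : Set (Fin n → M.L)) : Prop :=
  ∃ φ : Formula C K, ∀ (v : M.Assignment) (y : Fin n → M.L), y ∈ S ↔ φ.Realize M (v.setL y)

/-- `L` is, in `M`, a pure algebraically closed field of characteristic `0` with additional
constants: it is an algebraically closed field, and there is a set `A ⊆ L`, containing the constants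
from `K`, such that the subsets of the powers of `L` that are definable in `M` without parameters
are precisely those that are definable in the field `L` with constants for the elements of `A`. -/
def Struct.IsPureACF (M : Struct.{v, u, r, w} C K) : Prop :=
  (FirstOrder.Language.Theory.ACF 0).Model M.L ∧
    ∃ A : Set M.L, (∀ a : K, M.const a ∈ A) ∧
      ∀ (n : ℕ) (S : Set (Fin n → M.L)),
        M.DefinableL S ↔ A.Definable FirstOrder.Language.ring S

end TheField

end TensorTheory

end

/-! In a model each `V_X` has finite dimension over `L`, so a choice of bases turns every element
into a tuple of coordinates in `L`, and the maps `v_f`, the pairings `b_{X,Y}` and the constants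
into structure constants in `L`. Terms become polynomials in these quantities, and quantifiers over
`V_X` become quantifiers over tuples from `L`. Each formula thus becomes a formula in the language
of rings that depends only on the dimensions (`Formula.realize_toRing`, `exists_ringFormula`). This
is stable embeddedness: the parameters in `L` are structure constants and coordinates.

For stability, Chevalley's theorem shows that a definable set in an algebraically closed field is
constructible, so membership depends only on which of finitely many polynomials vanish
(`finitelyDetermined_realize`). A polynomial evaluated at coordinates of `a_i` and `b_j` is a finite
sum of products of a function of `i` and a function of `j`, that is, a pairing of vectors in a
finite-dimensional space. Vanishing of such a pairing commutes with iterated limits along an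
ultrafilter, while the relation `i < j` does not (`eventually_eval_merge_swap`,
`FinitelyDetermined.not_order`).

For purity, `A` consists of the elements of `L` that are definable in `M` without parameters. A
subset of `Lⁿ` definable in `M` without parameters is, by stable embeddedness, definable in the
field `L` with some parameters; these must be moved into `A`. The Zariski closure of such a set is
defined over `A`, because the reduced echelon basis of a space of polynomials vanishing on it is
unique and hence has definable entries (`definable_closure`). Noetherian induction on closed sets
passes from closures to the set itself (`FinitelyDetermined.definable`). -/

noncomputable section

namespace TensorTheory

/-! ## Semantics of the abbreviations -/

section Assignments

variable {C : Type u} [Category.{v} C] [MonoidalCategory C] {K : Type r}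
  {M : Struct.{v, u, r, w} C K}

namespace Struct.Assignment

@[simp]
lemma update_same (a : M.Assignment) (X : C) (n : ℕ) (x : M.carrier X) :
    a.update X n x X n = x := by
  simp [update]

@[simp]
lemma update_of_ne (a : M.Assignment) (X Y : C) {m n : ℕ} (x : M.carrier X) (h : m ≠ n) :
    a.update X n x Y m = a Y m := by
  by_cases hXY : Y = X
  · subst hXY; simp [update, h]
  · simp [update, hXY]

lemma update_of_ne_sort (a : M.Assignment) {X Y : C} (m n : ℕ) (x : M.carrier X) (h : Y ≠ X) :
    a.update X n x Y m = a Y m := by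
  simp [update, h]

open Classical in
/-- The assignment that gives the values `x 0, …, x (n - 1)` to the variables `N, …, N + n - 1` of
the sort `V_X`. -/
def updateBlock (a : M.Assignment) (X : C) (N : ℕ) {n : ℕ} (x : Fin n → M.carrier X) :
    M.Assignment :=
  Function.update a X fun i => if h : N ≤ i ∧ i < N + n then x ⟨i - N, by omega⟩ else a X i

@[simp]
lemma updateBlock_add (a : M.Assignment) (X : C) (N : ℕ) {n : ℕ} (x : Fin n → M.carrier X)
    (i : Fin n) : a.updateBlock X N x X (N + i) = x i := by
  simp [updateBlock]

@[simp]
lemma updateBlock_of_lt (a : M.Assignment) (X Y : C) {m N n : ℕ} (x : Fin n → M.carrier X)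
    (h : m < N) : a.updateBlock X N x Y m = a Y m := by
  by_cases hXY : Y = X
  · subst hXY
    simp [updateBlock, h]
  · simp [updateBlock, hXY]

@[simp]
lemma updateBlock_of_le (a : M.Assignment) (X Y : C) {m N n : ℕ} (x : Fin n → M.carrier X)
    (h : N + n ≤ m) : a.updateBlock X N x Y m = a Y m := by
  by_cases hXY : Y = X
  · subst hXY
    simp [updateBlock, h]
  · simp [updateBlock, hXY]

lemma updateBlock_zero (a : M.Assignment) (X : C) (N : ℕ) (x : Fin 0 → M.carrier X) :
    a.updateBlock X N x = a := by
  ext Y m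
  rcases lt_or_ge m N with h | h
  · exact updateBlock_of_lt _ _ _ _ h
  · exact updateBlock_of_le _ _ _ _ (by simpa using h)

lemma update_updateBlock (a : M.Assignment) (X : C) (N : ℕ) {n : ℕ}
    (x : Fin (n + 1) → M.carrier X) :
    (a.updateBlock X N (Fin.init x)).update X (N + n) (x (Fin.last n)) = a.updateBlock X N x := by
  ext Y m
  by_cases hXY : Y = X
  · subst hXY
    rcases lt_trichotomy m (N + n) with h | rfl | h
    · rw [update_of_ne _ _ _ _ h.ne]
      rcases lt_or_ge m N with h' | h'
      · simp [h']
      · obtain ⟨i, rfl⟩ := Nat.exists_eq_add_of_le h'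
        have hi : i < n := by omega
        exact (updateBlock_add _ _ _ _ ⟨i, hi⟩).trans
          (updateBlock_add a Y N x ⟨i, by omega⟩).symm
    · rw [update_same]
      exact (updateBlock_add a Y N x (Fin.last n)).symm
    · rw [update_of_ne _ _ _ _ h.ne', updateBlock_of_le _ _ _ _ h.le,
        updateBlock_of_le _ _ _ _ (by omega)]
  · simp [updateBlock, update, hXY]

lemma setL_of_lt (a : M.Assignment) {n m : ℕ} (y : Fin n → M.L) (h : m < n) :
    a.setL y (𝟙_ C) m = y ⟨m, h⟩ := by
  simp only [setL, Function.update_self]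
  exact dif_pos h

lemma setL_of_le (a : M.Assignment) {n m : ℕ} (y : Fin n → M.L) (h : n ≤ m) :
    a.setL y (𝟙_ C) m = a (𝟙_ C) m := by
  simp only [setL, Function.update_self]
  exact dif_neg h.not_gt

lemma setL_eq_updateBlock (a : M.Assignment) {n : ℕ} (y : Fin n → M.L) :
    a.setL y = a.updateBlock (𝟙_ C) 0 (n := n) y := by
  ext X m
  by_cases hX : X = 𝟙_ C
  · subst hX
    rcases lt_or_ge m n with h | h
    · rw [setL_of_lt a y h]
      simpa using (updateBlock_add a (𝟙_ C) 0 (n := n) y ⟨m, h⟩).symm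
    · rw [setL_of_le a y h]
      exact (updateBlock_of_le (N := 0) (n := n) a _ _ y (by omega)).symm
  · simp [setL, updateBlock, hX]

end Struct.Assignment

namespace Formula

variable {v : M.Assignment}

@[simp]
lemma realize_neg (φ : Formula C K) : (neg φ).Realize M v ↔ ¬ φ.Realize M v := Iff.rfl

@[simp]
lemma realize_verum : (verum : Formula C K).Realize M v := id

@[simp]
lemma realize_and (φ ψ : Formula C K) :
    (φ.and ψ).Realize M v ↔ φ.Realize M v ∧ ψ.Realize M v := by
  simp [Formula.and, neg, Realize]

@[simp]
lemma realize_ex (X : C) (n : ℕ) (φ : Formula C K) :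
    (ex X n φ).Realize M v ↔ ∃ x : M.carrier X, φ.Realize M (v.update X n x) := by
  simp [ex, neg, Realize]

@[simp]
lemma realize_exBlock (X : C) (N n : ℕ) (φ : Formula C K) :
    (exBlock X N n φ).Realize M v ↔
      ∃ x : Fin n → M.carrier X, φ.Realize M (v.updateBlock X N x) := by
  induction n generalizing φ with
  | zero => simp [exBlock, Struct.Assignment.updateBlock_zero]
  | succ n ih =>
    simp only [exBlock, ih, realize_ex]
    constructor
    · rintro ⟨x, y, h⟩
      refine ⟨Fin.snoc x y, ?_⟩
      rw [← Struct.Assignment.update_updateBlock]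
      simpa using h
    · rintro ⟨x, h⟩
      exact ⟨Fin.init x, x (Fin.last n), by rwa [Struct.Assignment.update_updateBlock]⟩

@[simp]
lemma realize_allBlock (X : C) (N n : ℕ) (φ : Formula C K) :
    (allBlock X N n φ).Realize M v ↔
      ∀ x : Fin n → M.carrier X, φ.Realize M (v.updateBlock X N x) := by
  induction n generalizing φ with
  | zero => simp [allBlock, Struct.Assignment.updateBlock_zero]
  | succ n ih =>
    simp only [allBlock, ih, Realize]
    constructor
    · intro h x
      rw [← Struct.Assignment.update_updateBlock]
      exact h _ _
    · intro h x y
      have := h (Fin.snoc x y)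
      rw [← Struct.Assignment.update_updateBlock] at this
      simpa using this

lemma realize_conj (l : List (Formula C K)) :
    (conj l).Realize M v ↔ ∀ φ ∈ l, φ.Realize M v := by
  induction l with
  | nil => simp [conj]
  | cons φ l ih =>
    change (φ.and (conj l)).Realize M v ↔ _
    simp [ih]

end Formula

end Assignments

/-! ## The linear algebra in a model -/

section VectorSpaces

variable {C : Type u} [Category.{v} C] [MonoidalCategory C] {K : Type r} [Field K]

/-- The sort `L` is a field and the sorts `V_X` are vector spaces over `L`, on which the maps `v_f`
are linear and `b_{X,Y}` bilinear. -/
class Struct.VectorSpaces (M : Struct.{v, u, r, w} C K) : Prop where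
  add_assoc : ∀ {X : C} (x y z : M.carrier X), M.add (M.add x y) z = M.add x (M.add y z)
  add_comm : ∀ {X : C} (x y : M.carrier X), M.add x y = M.add y x
  add_zero : ∀ {X : C} (x y : M.carrier X), M.add x (M.smul (M.const 0) y) = x
  smul_add : ∀ {X : C} (a : M.carrier (𝟙_ C)) (x y : M.carrier X),
    M.smul a (M.add x y) = M.add (M.smul a x) (M.smul a y)
  add_smul : ∀ {X : C} (a b : M.carrier (𝟙_ C)) (x : M.carrier X),
    M.smul (M.add a b) x = M.add (M.smul a x) (M.smul b x)
  mul_smul : ∀ {X : C} (a b : M.carrier (𝟙_ C)) (x : M.carrier X),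
    M.smul (M.smul a b) x = M.smul a (M.smul b x)
  one_smul : ∀ {X : C} (x : M.carrier X), M.smul (M.const 1) x = x
  L_add_zero : ∀ a : M.carrier (𝟙_ C), M.add a (M.const 0) = a
  L_mul_comm : ∀ a b : M.carrier (𝟙_ C), M.smul a b = M.smul b a
  L_zero_ne_one : M.const 0 ≠ M.const 1
  L_inv : ∀ a : M.carrier (𝟙_ C), a ≠ M.const 0 → ∃ b, M.smul a b = M.const 1
  const_add : ∀ a b : K, M.add (M.const a) (M.const b) = M.const (a + b)
  const_mul : ∀ a b : K, M.smul (M.const a) (M.const b) = M.const (a * b)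
  map_add : ∀ {X Y : C} (f : X ⟶ Y) (x y : M.carrier X),
    M.map f (M.add x y) = M.add (M.map f x) (M.map f y)
  map_smul : ∀ {X Y : C} (f : X ⟶ Y) (a : M.carrier (𝟙_ C)) (x : M.carrier X),
    M.map f (M.smul a x) = M.smul a (M.map f x)
  tensor_add_left : ∀ {X Y : C} (x x' : M.carrier X) (y : M.carrier Y),
    M.tensor (M.add x x') y = M.add (M.tensor x y) (M.tensor x' y)
  tensor_add_right : ∀ {X Y : C} (x : M.carrier X) (y y' : M.carrier Y),
    M.tensor x (M.add y y') = M.add (M.tensor x y) (M.tensor x y')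
  tensor_smul_left : ∀ {X Y : C} (a : M.carrier (𝟙_ C)) (x : M.carrier X) (y : M.carrier Y),
    M.tensor (M.smul a x) y = M.smul a (M.tensor x y)
  tensor_smul_right : ∀ {X Y : C} (a : M.carrier (𝟙_ C)) (x : M.carrier X) (y : M.carrier Y),
    M.tensor x (M.smul a y) = M.smul a (M.tensor x y)

namespace Struct

variable (M : Struct.{v, u, r, w} C K)

instance (X : C) : Nonempty (M.carrier X) := M.nonempty X

/-- An arbitrary assignment. -/
def someAssignment : M.Assignment := fun _ _ => Classical.arbitrary _

variable [hM : M.VectorSpaces]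

lemma L_zero_add (a : M.carrier (𝟙_ C)) : M.add (M.const 0) a = a :=
  (hM.add_comm _ _).trans (hM.L_add_zero a)

lemma smul_const_zero_eq {X : C} (x y : M.carrier X) :
    M.smul (M.const 0) x = M.smul (M.const 0) y := by
  rw [← hM.add_zero (M.smul (M.const 0) x) y, hM.add_comm, hM.add_zero]

lemma const_zero_smul (a : M.carrier (𝟙_ C)) : M.smul (M.const 0) a = M.const 0 := by
  rw [← M.L_zero_add (M.smul _ _), hM.add_zero]

lemma neg_add {X : C} (x : M.carrier X) :
    M.add (M.smul (M.const (-1)) x) x = M.smul (M.const 0) x := by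
  nth_rewrite 2 [← hM.one_smul x]
  rw [← hM.add_smul, hM.const_add, neg_add_cancel]

lemma smul_smul_const_zero {X : C} (a : M.carrier (𝟙_ C)) (x : M.carrier X) :
    M.smul a (M.smul (M.const 0) x) = M.smul (M.const 0) x := by
  rw [← hM.mul_smul, hM.L_mul_comm, hM.mul_smul]
  exact M.smul_const_zero_eq _ _

instance (X : C) : Zero (M.carrier X) := ⟨M.smul (M.const 0) (Classical.arbitrary _)⟩

instance (X : C) : Add (M.carrier X) := ⟨M.add⟩

instance (X : C) : Neg (M.carrier X) := ⟨M.smul (M.const (-1))⟩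

instance (X : C) : AddCommGroup (M.carrier X) where
  add_assoc := hM.add_assoc
  zero_add x := (hM.add_comm _ _).trans (hM.add_zero x _)
  add_zero x := hM.add_zero x _
  neg_add_cancel x := (M.neg_add x).trans (M.smul_const_zero_eq _ _)
  add_comm := hM.add_comm
  nsmul := nsmulRec
  zsmul := zsmulRec

-- The zero of the field `L` is the constant, not the chosen zero vector of `V_𝟙`, so that the field
-- agrees definitionally with the structure in the language of rings; `scalar` passes between `V_𝟙`
-- and `L`.
instance : Zero M.L := ⟨M.const 0⟩

instance : One M.L := ⟨M.const 1⟩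

instance : Add M.L := ⟨M.add (X := 𝟙_ C)⟩

instance : Neg M.L := ⟨M.smul (X := 𝟙_ C) (M.const (-1))⟩

instance : Mul M.L := ⟨M.smul (X := 𝟙_ C)⟩

open Classical in
instance : Inv M.L := ⟨fun a => if h : ∃ b : M.L, a * b = 1 then h.choose else 0⟩

instance : Field M.L where
  add_assoc := hM.add_assoc (X := 𝟙_ C)
  zero_add := M.L_zero_add
  add_zero := hM.L_add_zero
  neg_add_cancel a := (M.neg_add (X := 𝟙_ C) a).trans (M.const_zero_smul a)
  add_comm := hM.add_comm (X := 𝟙_ C)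
  mul_assoc := hM.mul_smul (X := 𝟙_ C)
  mul_comm := hM.L_mul_comm
  one_mul := hM.one_smul (X := 𝟙_ C)
  mul_one a := (hM.L_mul_comm _ _).trans (hM.one_smul (X := 𝟙_ C) a)
  left_distrib := hM.smul_add (X := 𝟙_ C)
  right_distrib := hM.add_smul (X := 𝟙_ C)
  zero_mul := M.const_zero_smul
  mul_zero a := (hM.L_mul_comm _ _).trans (M.const_zero_smul a)
  exists_pair_ne := ⟨0, 1, hM.L_zero_ne_one⟩
  mul_inv_cancel a ha := by
    have h : ∃ b : M.L, a * b = 1 := hM.L_inv a ha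
    simp only [Inv.inv, dif_pos h]
    exact h.choose_spec
  inv_zero := dif_neg fun ⟨b, hb⟩ => hM.L_zero_ne_one ((M.const_zero_smul b).symm.trans hb)
  nsmul := nsmulRec
  zsmul := zsmulRec
  qsmul := _
  nnqsmul := _

instance (X : C) : Module M.L (M.carrier X) where
  smul := M.smul
  one_smul := hM.one_smul
  mul_smul := hM.mul_smul
  smul_zero a := M.smul_smul_const_zero a _
  smul_add := hM.smul_add
  add_smul := hM.add_smul
  zero_smul x := M.smul_const_zero_eq x _

instance compatibleRing : FirstOrder.Ring.CompatibleRing M.L where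
  toStructure := M.ringStructure
  funMap_add _ := rfl
  funMap_mul _ := rfl
  funMap_neg _ := rfl
  funMap_zero _ := rfl
  funMap_one _ := rfl

variable {M}

omit [Field K] hM in
lemma add_eq {X : C} (x y : M.carrier X) : M.add x y = x + y := rfl

variable (M) in
/-- The sort `V_𝟙` as a one-dimensional vector space. -/
def scalar : M.carrier (𝟙_ C) ≃ₗ[M.L] M.L where
  toFun a := a
  map_add' _ _ := rfl
  map_smul' _ _ := rfl
  invFun a := a
  left_inv _ := rfl
  right_inv _ := rfl

lemma smul_eq {X : C} (a : M.carrier (𝟙_ C)) (x : M.carrier X) :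
    M.smul a x = M.scalar a • x := rfl

lemma const_zero : M.const 0 = 0 :=
  M.scalar.injective ((map_zero M.scalar).symm)

variable (M) in
/-- The inclusion of the constants into `L`. -/
def constHom : K →+* M.L where
  toFun := M.const
  map_one' := rfl
  map_mul' a b := (hM.const_mul a b).symm
  map_zero' := rfl
  map_add' a b := (hM.const_add a b).symm

variable (M) in
/-- The linear map `v_f`. -/
def linearMap {X Y : C} (f : X ⟶ Y) : M.carrier X →ₗ[M.L] M.carrier Y where
  toFun := M.map f
  map_add' := hM.map_add f
  map_smul' := hM.map_smul f

variable (M) in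
/-- The bilinear map `b_{X,Y}`. -/
def bilinearMap (X Y : C) : M.carrier X →ₗ[M.L] M.carrier Y →ₗ[M.L] M.carrier (X ⊗ Y) :=
  LinearMap.mk₂ M.L M.tensor hM.tensor_add_left hM.tensor_smul_left hM.tensor_add_right
    (fun a x y => hM.tensor_smul_right a x y)

lemma map_eq {X Y : C} (f : X ⟶ Y) (x : M.carrier X) : M.map f x = M.linearMap f x := rfl

lemma tensor_eq {X Y : C} (x : M.carrier X) (y : M.carrier Y) :
    M.tensor x y = M.bilinearMap X Y x y := rfl

lemma value_zero (a : M.Assignment) (X : C) : (Term.zero X : Term C K X).value M a = 0 :=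
  M.smul_const_zero_eq _ _

lemma value_lincomb (v : M.Assignment) {X : C} {n : ℕ} (a : Fin n → Term C K (𝟙_ C))
    (t : Fin n → Term C K X) :
    (Term.lincomb a t).value M v = ∑ i, M.scalar ((a i).value M v) • (t i).value M v := by
  rw [← List.sum_ofFn, Term.lincomb]
  have (l : List (Term C K X)) :
      (l.foldr Term.add (Term.zero X)).value M v = (l.map fun t => t.value M v).sum := by
    induction l with
    | nil => exact value_zero v X
    | cons t l ih => simpa [Term.value, add_eq] using ih
  rw [this, List.map_ofFn]
  rfl

lemma value_pow (v : M.Assignment) (t : Term C K (𝟙_ C)) (n : ℕ) :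
    M.scalar ((t.pow n).value M v) = M.scalar (t.value M v) ^ n := by
  induction n with
  | zero => rfl
  | succ n ih => rw [pow_succ', ← ih]; rfl

end Struct

end VectorSpaces

/-! ## Models of the theory -/

section Models

variable {k : Type*} [Field k] {C : Type u} [Category.{v} C] [Abelian C] [MonoidalCategory C]
  [SymmetricCategory C] [RigidCategory C] [Linear k C] {K : Type r} [Field K] [Algebra k K]
  {M : Struct.{v, u, r, w} C K} (hM : M.Models (theory k C K))

include hM

open Term Formula

lemma Struct.Models.vectorSpaces : M.VectorSpaces := by
  have key (φ : Formula C K) (h : IsAxiom k C K φ) (a : M.Assignment) : φ.Realize M a := hM φ h a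
  let a := M.someAssignment
  constructor
  · intro X x y z
    simpa [Realize, value] using
      key _ (.add_assoc X) (((a.update X 0 x).update X 1 y).update X 2 z)
  · intro X x y
    simpa [Realize, value] using key _ (.add_comm X) ((a.update X 0 x).update X 1 y)
  · intro X x y
    simpa [Realize, value, zero] using key _ (.add_zero X) ((a.update X 1 x).update X 0 y)
  · intro X b x y
    simpa [Realize, value] using
      key _ (.smul_add X) (((a.update X 0 x).update X 1 y).update _ 3 b)
  · intro X b c x
    simpa [Realize, value] using
      key _ (.add_smul X) (((a.update X 0 x).update _ 3 b).update _ 4 c)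
  · intro X b c x
    simpa [Realize, value] using
      key _ (.mul_smul X) (((a.update X 0 x).update _ 3 b).update _ 4 c)
  · intro X x
    simpa [Realize, value] using key _ (.one_smul X) (a.update X 0 x)
  · intro b
    simpa [Realize, value] using key _ .L_add_zero (a.update _ 3 b)
  · intro b c
    simpa [Realize, value] using key _ .L_mul_comm ((a.update _ 3 b).update _ 4 c)
  · simpa [Realize, value] using key _ .L_zero_ne_one a
  · intro b
    simpa [Realize, value] using key _ .L_inv (a.update _ 3 b)
  · intro b c
    simpa [Realize, value] using key _ (.const_add b c) a
  · intro b c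
    simpa [Realize, value] using key _ (.const_mul b c) a
  · intro X Y f x y
    simpa [Realize, value] using key _ (.map_add f) ((a.update X 0 x).update X 1 y)
  · intro X Y f b x
    simpa [Realize, value] using key _ (.map_smul f) ((a.update X 0 x).update _ 3 b)
  · intro X Y x x' y
    simpa [Realize, value] using
      key _ (.tensor_add_left X Y) (((a.update X 0 x).update X 1 x').update Y 2 y)
  · intro X Y x y y'
    simpa [Realize, value] using
      key _ (.tensor_add_right X Y) (((a.update X 0 x).update Y 1 y).update Y 2 y')
  · intro X Y b x y
    simpa [Realize, value] using
      key _ (.tensor_smul_left X Y) (((a.update X 0 x).update Y 1 y).update _ 3 b)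
  · intro X Y b x y
    simpa [Realize, value] using
      key _ (.tensor_smul_right X Y) (((a.update X 0 x).update Y 1 y).update _ 3 b)

variable [M.VectorSpaces]

lemma Struct.Models.isAlgClosed : IsAlgClosed M.L := by
  refine IsAlgClosed.of_exists_root _ fun p hp hirr => ?_
  have hn : 0 < p.natDegree := hirr.natDegree_pos
  -- In `rootFormula` the variables below the degree are the non-leading coefficients, and the
  -- variable indexed by the degree is the root.
  have h := hM _ (.L_root _ hn) (M.someAssignment.updateBlock (𝟙_ C) 0 fun i : Fin p.natDegree =>
    M.scalar.symm (p.coeff i))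
  simp only [rootFormula, realize_ex] at h
  obtain ⟨x, hx⟩ := h
  refine ⟨M.scalar x, ?_⟩
  replace hx := congrArg M.scalar hx
  simp only [value, M.add_eq, M.value_lincomb, map_add, map_sum, map_smul, M.value_pow,
    Struct.Assignment.update_same, M.const_zero, map_zero, smul_eq_mul] at hx
  rw [hp.as_sum, Polynomial.eval_add, Polynomial.eval_finsetSum, Finset.sum_range]
  simp only [Polynomial.eval_pow, Polynomial.eval_X, Polynomial.eval_mul, Polynomial.eval_C]
  rw [← hx]
  congr 1
  refine Finset.sum_congr rfl fun i _ => ?_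
  congr 1
  rw [Struct.Assignment.update_of_ne _ _ _ _ i.2.ne]
  have := Struct.Assignment.updateBlock_add M.someAssignment (𝟙_ C) 0
    (fun i : Fin p.natDegree => M.scalar.symm (p.coeff i)) i
  rw [zero_add] at this
  rw [this, LinearEquiv.apply_symm_apply]

lemma Struct.Models.nonempty_basis {X : C} {n : ℕ} (hn : HasRank X n) :
    Nonempty (Module.Basis (Fin n) M.L (M.carrier X)) := by
  have h := hM _ (.dim X n hn) M.someAssignment
  simp only [dimFormula, basisFormula, realize_exBlock, realize_and, realize_allBlock] at h
  obtain ⟨b, h₁, h₂⟩ := h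
  have hb (i : Fin n) : M.someAssignment.updateBlock X 0 b X i = b i := by
    simpa using Struct.Assignment.updateBlock_add M.someAssignment X 0 b i
  refine ⟨Module.Basis.mk (v := b) ?_ ?_⟩
  · rw [Fintype.linearIndependent_iff]
    intro g hg i
    have := h₂ fun i => M.scalar.symm (g i)
    simp only [Realize, value, M.value_lincomb, M.value_zero, Struct.Assignment.updateBlock_add,
      Struct.Assignment.updateBlock_of_lt, Fin.is_lt, hb, LinearEquiv.apply_symm_apply, hg,
      List.mem_ofFn, forall_const, realize_conj, forall_exists_index, forall_apply_eq_imp_iff] at this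
    have := congrArg M.scalar (this i)
    simpa [Realize, value, M.const_zero] using this
  · rintro x -
    rw [Realize] at h₁
    obtain ⟨c, hc⟩ := (realize_exBlock _ _ _ _).mp (h₁ x)
    simp only [Realize, value, M.value_lincomb, Struct.Assignment.updateBlock_add,
      Struct.Assignment.updateBlock_of_lt, Struct.Assignment.updateBlock_of_le, le_refl, Fin.is_lt,
      Struct.Assignment.update_same] at hc
    rw [hc]
    refine Submodule.sum_mem _ fun i _ => Submodule.smul_mem _ _ (Submodule.subset_span ⟨i, ?_⟩)
    -- The vector to be expanded is the variable `2n`, past the `n` basis vectors and the `n`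
    -- coefficients.
    rw [Struct.Assignment.update_of_ne _ _ _ _ (by omega), hb]

end Models

end TensorTheory

end

noncomputable section

/-! ## Definable sets in algebraically closed fields -/

namespace ACFDefinable

open MvPolynomial FirstOrder Topology

/-! ### Constructible sets of rational points and their projections. -/

section Chevalley

variable {F : Type*} [Field F] {σ τ : Type*}

/-- A subset of affine space is constructible if it consists of the rational points in a
constructible subset of the prime spectrum of the polynomial ring. -/
def IsConstr (S : Set (σ → F)) : Prop :=
  ∃ Z : Set (PrimeSpectrum (MvPolynomial σ F)), IsConstructible Z ∧
    ∀ x, x ∈ S ↔ (pointToPoint x : PrimeSpectrum (MvPolynomial σ F)) ∈ Z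

lemma IsConstr.compl {S : Set (σ → F)} (h : IsConstr S) : IsConstr Sᶜ := by
  obtain ⟨Z, hZ, h⟩ := h
  exact ⟨Zᶜ, hZ.compl, fun x => not_congr (h x)⟩

lemma IsConstr.union {S T : Set (σ → F)} (hS : IsConstr S) (hT : IsConstr T) :
    IsConstr (S ∪ T) := by
  obtain ⟨Z, hZ, hS⟩ := hS
  obtain ⟨W, hW, hT⟩ := hT
  exact ⟨Z ∪ W, hZ.union hW, fun x => or_congr (hS x) (hT x)⟩

lemma isConstr_empty : IsConstr (∅ : Set (σ → F)) :=
  ⟨∅, .empty, fun _ => Iff.rfl⟩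

lemma pointToPoint_mem_zeroLocus (x : σ → F) (s : Set (MvPolynomial σ F)) :
    (pointToPoint x : PrimeSpectrum (MvPolynomial σ F)) ∈ PrimeSpectrum.zeroLocus s ↔
      ∀ p ∈ s, eval x p = 0 := by
  simp [PrimeSpectrum.mem_zeroLocus, pointToPoint, Set.subset_def, aeval_eq_eval]

lemma isConstr_eval_eq_zero (p : MvPolynomial σ F) : IsConstr {x : σ → F | eval x p = 0} := by
  refine ⟨PrimeSpectrum.zeroLocus {p}, ?_, fun x => ?_⟩
  · rw [← isConstructible_compl, ← PrimeSpectrum.basicOpen_eq_zeroLocus_compl]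
    exact PrimeSpectrum.isConstructible_basicOpen
  · rw [pointToPoint_mem_zeroLocus]; simp

lemma comap_rename_pointToPoint (i : σ → τ) (y : τ → F) :
    PrimeSpectrum.comap (rename (R := F) i).toRingHom (pointToPoint y) = pointToPoint (y ∘ i) := by
  ext p
  simp [pointToPoint, aeval_rename]

lemma pointToPoint_injective :
    Function.Injective (pointToPoint : (σ → F) → PrimeSpectrum (MvPolynomial σ F)) := by
  intro x y h
  ext s
  have : (X s - C (x s) : MvPolynomial σ F) ∈ (pointToPoint y).asIdeal := by
    rw [← h]; simp [pointToPoint]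
  simpa [pointToPoint, sub_eq_zero, eq_comm] using this

/-- A set of points that is determined by the vanishing of finitely many polynomials. -/
def FinitelyDetermined (S : Set (σ → F)) : Prop :=
  ∃ P : Set (MvPolynomial σ F), P.Finite ∧
    ∀ x y : σ → F, (∀ p ∈ P, eval x p = 0 ↔ eval y p = 0) → (x ∈ S ↔ y ∈ S)

/-- A constructible set is a finite union of sets cut out by finitely many equations and one
inequation; the polynomials occurring there suffice. -/
lemma IsConstr.finitelyDetermined {S : Set (σ → F)} (h : IsConstr S) :
    FinitelyDetermined S := by
  obtain ⟨Z, hZ, h⟩ := h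
  obtain ⟨D, rfl⟩ := PrimeSpectrum.exists_constructibleSetData_iff.mpr hZ
  refine ⟨⋃ C ∈ D, insert C.f (Set.range C.g), ?_, fun x y hxy => ?_⟩
  · exact D.finite_toSet.biUnion fun C _ => (Set.finite_range _).insert _
  · rw [h, h]
    simp only [PrimeSpectrum.ConstructibleSetData.toSet,
      PrimeSpectrum.BasicConstructibleSetData.toSet, Set.mem_iUnion, Set.mem_sdiff,
      pointToPoint_mem_zeroLocus]
    refine exists_congr fun C => exists_congr fun hC => and_congr ?_ (not_congr ?_)
    · refine forall₂_congr fun p hp => hxy p ?_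
      exact Set.mem_biUnion hC (Set.mem_insert_of_mem _ hp)
    · refine forall₂_congr fun p hp => hxy p ?_
      rw [Set.mem_singleton_iff.mp hp]
      exact Set.mem_biUnion hC (Set.mem_insert _ _)

variable [IsAlgClosed F] [Finite σ] [Finite τ]

/-- Chevalley's theorem for coordinate projections. -/
lemma IsConstr.proj {S : Set (τ → F)} (h : IsConstr S) (i : σ → τ) :
    IsConstr {x : σ → F | ∃ y ∈ S, y ∘ i = x} := by
  obtain ⟨Z, hZ, h⟩ := h
  let f : MvPolynomial σ F →+* MvPolynomial τ F := (rename (R := F) i).toRingHom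
  have hf : f.FinitePresentation := by
    refine RingHom.FinitePresentation.of_comp_finiteType (C : F →+* MvPolynomial σ F)
      ?_ ?_
    · have : f.comp C = (C : F →+* MvPolynomial τ F) := by ext; simp [f]
      rw [this]
      exact RingHom.finitePresentation_algebraMap.mpr inferInstance
    · exact RingHom.finiteType_algebraMap.mpr inferInstance
  refine ⟨_, PrimeSpectrum.isConstructible_comap_image hf hZ, fun x => ⟨?_, ?_⟩⟩
  · rintro ⟨y, hy, rfl⟩
    exact ⟨_, (h y).mp hy, comap_rename_pointToPoint i y⟩
  · rintro ⟨q, hq, hqx⟩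
    obtain ⟨D, rfl⟩ := PrimeSpectrum.exists_constructibleSetData_iff.mpr hZ
    obtain ⟨E, hE, hqE⟩ : ∃ E ∈ D, q ∈ E.toSet := by
      simpa [PrimeSpectrum.ConstructibleSetData.toSet] using hq
    have hclosed : IsClosed (PrimeSpectrum.comap f ⁻¹' {pointToPoint x}) := by
      refine IsClosed.preimage (PrimeSpectrum.continuous_comap f) ?_
      rw [PrimeSpectrum.isClosed_singleton_iff_isMaximal]
      exact isMaximal_iff_eq_vanishingIdeal_singleton.mpr ⟨x, rfl⟩
    -- The image of `Z` is constructible by Chevalley, but a point over `x` need not be rational.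
    -- The part of the fibre in one locally closed piece is nonempty and locally closed in a
    -- Jacobson space, so it contains a closed point, which is rational by the Nullstellensatz.
    have hlc : IsLocallyClosed (E.toSet ∩ PrimeSpectrum.comap f ⁻¹' {pointToPoint x}) := by
      refine IsLocallyClosed.inter ?_ hclosed.isLocallyClosed
      exact (PrimeSpectrum.isClosed_zeroLocus _).isLocallyClosed.inter
        (PrimeSpectrum.isClosed_zeroLocus _).isOpen_compl.isLocallyClosed
    obtain ⟨m, ⟨hmE, hmx⟩, hm⟩ :=
      nonempty_inter_closedPoints (Set.nonempty_of_mem (Set.mem_inter hqE hqx)) hlc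
    rw [mem_closedPoints_iff, PrimeSpectrum.isClosed_singleton_iff_isMaximal,
      isMaximal_iff_eq_vanishingIdeal_singleton] at hm
    obtain ⟨y, hy⟩ := hm
    obtain rfl : m = pointToPoint y := PrimeSpectrum.ext hy
    refine ⟨y, (h y).mpr (Set.mem_biUnion hE hmE), ?_⟩
    apply pointToPoint_injective
    rw [← comap_rename_pointToPoint]
    exact hmx

end Chevalley

/-! ### Formulas in the language of rings define constructible sets. -/

section Formulas

variable {F : Type*} [Field F] [Ring.CompatibleRing F]

lemma exists_eval_eq_realize {α : Type*} (t : Language.ring.Term α) :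
    ∃ p : MvPolynomial α F, ∀ x : α → F, eval x p = t.realize x := by
  induction t with
  | var a => exact ⟨X a, fun x => by simp⟩
  | func f ts ih =>
    choose p hp using ih
    cases f with
    | add =>
      exact ⟨p 0 + p 1, fun x => by
        rw [map_add, hp, hp]
        exact (Ring.CompatibleRing.funMap_add (R := F) fun i => (ts i).realize x).symm⟩
    | mul =>
      exact ⟨p 0 * p 1, fun x => by
        rw [map_mul, hp, hp]
        exact (Ring.CompatibleRing.funMap_mul (R := F) fun i => (ts i).realize x).symm⟩
    | neg =>
      exact ⟨-p 0, fun x => by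
        rw [map_neg, hp]
        exact (Ring.CompatibleRing.funMap_neg (R := F) fun i => (ts i).realize x).symm⟩
    | zero =>
      exact ⟨0, fun x => (map_zero _).trans
        (Ring.CompatibleRing.funMap_zero (R := F) fun i => (ts i).realize x).symm⟩
    | one =>
      exact ⟨1, fun x => (map_one _).trans
        (Ring.CompatibleRing.funMap_one (R := F) fun i => (ts i).realize x).symm⟩

variable [IsAlgClosed F]

/-- Sets definable in an algebraically closed field are constructible. -/
lemma isConstr_realize_boundedFormula {α : Type*} [Finite α] {n : ℕ}
    (φ : Language.ring.BoundedFormula α n) :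
    IsConstr {x : α ⊕ Fin n → F | φ.Realize (x ∘ Sum.inl) (x ∘ Sum.inr)} := by
  induction φ with
  | falsum => exact isConstr_empty
  | equal s t =>
    obtain ⟨p, hp⟩ := exists_eval_eq_realize (F := F) s
    obtain ⟨q, hq⟩ := exists_eval_eq_realize (F := F) t
    convert isConstr_eval_eq_zero (p - q) using 3 with x
    simp [hp, hq, sub_eq_zero, Language.BoundedFormula.Realize]
  | rel R => nomatch R
  | imp φ ψ h₁ h₂ =>
    convert h₁.compl.union h₂ using 1
    ext x
    simp [Language.BoundedFormula.realize_imp, imp_iff_not_or]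
  | @all n φ h =>
    -- A universal quantifier is the complement of a projection of the complement.
    convert (h.compl.proj (Sum.map id Fin.castSucc : α ⊕ Fin n → α ⊕ Fin (n + 1))).compl using 1
    ext x
    simp only [Language.BoundedFormula.realize_all, Set.mem_ofPred_eq, Set.mem_compl_iff,
      not_exists, not_and]
    constructor
    · rintro h y hy rfl
      refine hy ?_
      convert h (y (Sum.inr (Fin.last n))) using 1
      · rfl
      refine _root_.funext fun j => Fin.lastCases ?_ (fun j => ?_) j <;> simp
    · intro h a
      by_contra hc
      refine h (Sum.elim (x ∘ Sum.inl) (Fin.snoc (x ∘ Sum.inr) a)) (by simpa using hc) ?_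
      ext (s | s) <;> simp

lemma finitelyDetermined_realize {α : Type*} [Finite α] (φ : Language.ring.Formula α) :
    FinitelyDetermined {x : α → F | φ.Realize x} := by
  obtain ⟨P, hP, h⟩ := (isConstr_realize_boundedFormula (F := F) φ).finitelyDetermined
  refine ⟨rename (Sum.elim id finZeroElim) '' P, hP.image _, fun x y hxy => ?_⟩
  have := h (x ∘ Sum.elim id finZeroElim) (y ∘ Sum.elim id finZeroElim) fun p hp => by
    simpa [eval_rename] using hxy _ (Set.mem_image_of_mem _ hp)
  simp only [Set.mem_ofPred_eq, Function.comp_assoc, Sum.elim_comp_inl, Function.comp_id] at this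
  simp only [Set.mem_ofPred_eq, Language.Formula.Realize]
  convert this

end Formulas

/-! ### Reduction to finitely many free variables. -/

section RestrictFreeVar

/-- A formula depends on finitely many of its free variables only. -/
lemma exists_restrict_realize {L : Language} {I β : Type*} (χ : L.Formula (I ⊕ β)) :
    ∃ (m : ℕ) (ι : Fin m → I) (ψ : L.Formula (Fin m ⊕ β)),
      ∀ (F : Type w) [L.Structure F] (x : I → F) (y : β → F),
        χ.Realize (Sum.elim x y) ↔ ψ.Realize (Sum.elim (x ∘ ι) y) := by
  classical
  let s := χ.freeVarFinset.toLeft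
  refine ⟨s.card, fun j => (s.equivFin.symm j).1,
    χ.restrictFreeVar fun a => match a with
      | ⟨.inl i, h⟩ => .inl (s.equivFin ⟨i, Finset.mem_toLeft.mpr h⟩)
      | ⟨.inr b, _⟩ => .inr b, fun F _ x y => ?_⟩
  refine (Language.BoundedFormula.realize_restrictFreeVar _ ?_).symm
  rintro ⟨i | b, h⟩ <;> simp

end RestrictFreeVar

/-! ### Iterated limits -/

section Limits

variable {F : Type*} [Field F]

/-- The pairing of a finite-dimensional space with its dual commutes with iterated limits, in one
direction. -/
lemma eventually_pairing_swap (U : Ultrafilter ℕ) (V : Type*)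
    [AddCommGroup V] [Module F V] [FiniteDimensional F V] (f : ℕ → V)
    (g : ℕ → Module.Dual F V) (h : ∀ᶠ i in U, ∀ᶠ j in U, g j (f i) = 0) :
    ∀ᶠ j in U, ∀ᶠ i in U, g j (f i) = 0 := by
  -- `W` collects the vectors killed by almost all `g j`. It is finitely generated, so almost every
  -- `g j` kills all of `W` at once, and almost every `f i` lies in `W` by hypothesis.
  let W : Submodule F V :=
    { carrier := {x | ∀ᶠ j in U, g j x = 0}
      add_mem' := fun hx hy => by
        filter_upwards [hx, hy] with j hx hy
        simp [hx, hy]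
      zero_mem' := by simp
      smul_mem' := fun c x hx => by
        filter_upwards [hx] with j hx
        simp [hx] }
  obtain ⟨s, hs⟩ := (IsNoetherian.noetherian W)
  have hW : ∀ᶠ j in U, ∀ x ∈ s, g j x = 0 := by
    rw [Filter.eventually_all_finset]
    intro x hx
    have : x ∈ W := hs ▸ Submodule.subset_span hx
    exact this
  filter_upwards [hW] with j hj
  filter_upwards [h] with i hi
  have hi : f i ∈ W := hi
  rw [← hs] at hi
  have : Submodule.span F (s : Set V) ≤ LinearMap.ker (g j) := Submodule.span_le.mpr hj
  exact this hi

lemma eventually_sum_mul_eq_zero_swap_iff {m : Type*} [Fintype m] (U : Ultrafilter ℕ)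
    (f g : ℕ → m → F) :
    (∀ᶠ i in U, ∀ᶠ j in U, ∑ l, f i l * g j l = 0) ↔
      ∀ᶠ j in U, ∀ᶠ i in U, ∑ l, f i l * g j l = 0 := by
  classical
  have key (f g : ℕ → m → F) (h : ∀ᶠ i in U, ∀ᶠ j in U, ∑ l, f i l * g j l = 0) :
      ∀ᶠ j in U, ∀ᶠ i in U, ∑ l, f i l * g j l = 0 := by
    have := eventually_pairing_swap U (m → F) f
      (fun j => Fintype.linearCombination F (g j)) (by
        simpa [Fintype.linearCombination_apply] using h)
    simpa [Fintype.linearCombination_apply] using this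
  refine ⟨key f g, fun h => ?_⟩
  have := key g f (by simpa only [mul_comm] using h)
  simpa only [mul_comm] using this

/-- A finitely determined set has no order property with respect to a double sequence along which
the vanishing of polynomials commutes with iterated limits. -/
lemma FinitelyDetermined.not_order {σ : Type*} {S : Set (σ → F)} (hS : FinitelyDetermined S)
    (x : ℕ → ℕ → σ → F)
    (hx : ∀ (p : MvPolynomial σ F) (U : Ultrafilter ℕ),
      (∀ᶠ i in U, ∀ᶠ j in U, eval (x i j) p = 0) ↔ ∀ᶠ j in U, ∀ᶠ i in U, eval (x i j) p = 0) :
    ¬ ∀ i j, x i j ∈ S ↔ i < j := by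
  intro h
  obtain ⟨P, hP, hPS⟩ := hS
  let U := Filter.hyperfilter ℕ
  have hgt (n : ℕ) : ∀ᶠ m in U, n < m := by
    have h : Filter.Tendsto id (U : Filter ℕ) Filter.atTop := by
      rw [← Nat.cofinite_eq_atTop]; exact Filter.hyperfilter_le_cofinite
    exact h.eventually_gt_atTop n
  -- `T p` is the limiting truth value of the vanishing of `p`, the same for both orders of the
  -- limits. It yields one pair with `i < j` and one with `j' < i'` on which all of `P` has the same
  -- vanishing pattern.
  let T (p : MvPolynomial σ F) : Prop := ∀ᶠ i in U, ∀ᶠ j in U, eval (x i j) p = 0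
  have h₁ : ∀ᶠ i in U, ∀ᶠ j in U, ∀ p ∈ P, eval (x i j) p = 0 ↔ T p := by
    simp only [Filter.eventually_all_finite hP]
    intro p _
    by_cases hT : T p
    · simp only [hT, iff_true]; exact hT
    · simp only [hT, iff_false, Ultrafilter.eventually_not]; exact hT
  have h₂ : ∀ᶠ j in U, ∀ᶠ i in U, ∀ p ∈ P, eval (x i j) p = 0 ↔ T p := by
    simp only [Filter.eventually_all_finite hP]
    intro p _
    by_cases hT : T p
    · simp only [hT, iff_true]; exact (hx p U).mp hT
    · simp only [hT, iff_false, Ultrafilter.eventually_not]; exact fun h => hT ((hx p U).mpr h)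
  obtain ⟨i, hi⟩ := h₁.exists
  obtain ⟨j, hj, hij⟩ := (hi.and (hgt i)).exists
  obtain ⟨j', hj'⟩ := h₂.exists
  obtain ⟨i', hi', hij'⟩ := (hj'.and (hgt j')).exists
  have := hPS _ _ fun p hp => (hj p hp).trans (hi' p hp).symm
  rw [h, h] at this
  omega

end Limits

end ACFDefinable

end

noncomputable section

namespace TensorTheory

/-! ## Translation into the language of rings -/

section Translation

open FirstOrder

variable (C : Type u) [Category.{v} C] [MonoidalCategory C] (K : Type r) (d : C → ℕ)

/-- Variables for the coordinates of all variables, and for the structure constants, of a model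
in which a basis of each `V_X` is chosen. -/
inductive CoordVar : Type (max u v r)
  | var (X : C) (n : ℕ) (i : Fin (d X)) : CoordVar
  | map {X Y : C} (f : X ⟶ Y) (i : Fin (d X)) (j : Fin (d Y)) : CoordVar
  | tensor (X Y : C) (i : Fin (d X)) (j : Fin (d Y)) (l : Fin (d (X ⊗ Y))) : CoordVar
  | const (c : K) (i : Fin (d (𝟙_ C))) : CoordVar
  | scalar (i : Fin (d (𝟙_ C))) : CoordVar

variable {C K d}

/-- The coordinates of a term, as polynomials. -/
def Term.coord : ∀ {X : C}, Term C K X → Fin (d X) → FreeCommRing (CoordVar C K d)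
  | _, .var X n => fun i => .of (.var X n i)
  | _, .const c => fun i => .of (.const c i)
  | _, .map f t => fun j => ∑ i, .of (.map f i j) * t.coord i
  | _, .add s t => fun i => s.coord i + t.coord i
  -- The dimension of `V_𝟙` is not taken to be `1`: a scalar is recovered from its coordinates and
  -- the values in `L` of the basis vectors.
  | _, .smul a t => fun i => (∑ j, .of (.scalar j) * a.coord j) * t.coord i
  | _, .tensor (X := X) (Y := Y) s t => fun l =>
      ∑ i, ∑ j, .of (.tensor X Y i j l) * (s.coord i * t.coord j)

open Classical in
/-- Separate the coordinates of the `n`-th variable of the sort `V_X` from all other variables. -/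
def CoordVar.split (X : C) (n : ℕ) : CoordVar C K d → CoordVar C K d ⊕ Fin (d X)
  | .var Y m i => if h : Y = X ∧ m = n then .inr (i.cast (congrArg d h.1)) else .inl (.var Y m i)
  | c => .inl c

/-- The translation of a formula into the language of rings. -/
def Formula.toRing : Formula C K → Language.ring.Formula (CoordVar C K d)
  | .falsum => ⊥
  | .equal s t => Language.BoundedFormula.iInf fun i =>
      Language.Term.equal (Ring.termOfFreeCommRing (s.coord i)) (Ring.termOfFreeCommRing (t.coord i))
  | .imp φ ψ => φ.toRing.imp ψ.toRing
  | .all X n φ => Language.Formula.iAlls (Fin (d X)) (φ.toRing.relabel (CoordVar.split X n))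

variable [Field K] {M : Struct.{v, u, r, w} C K} [M.VectorSpaces]
  (B : ∀ X : C, Module.Basis (Fin (d X)) M.L (M.carrier X))

/-- The values of the coordinates and structure constants. -/
def CoordVar.value (a : M.Assignment) : CoordVar C K d → M.L
  | .var X n i => (B X).repr (a X n) i
  | .map (X := X) (Y := Y) f i j => (B Y).repr (M.map f (B X i)) j
  | .tensor X Y i j l => (B (X ⊗ Y)).repr (M.tensor (B X i) (B Y j)) l
  | .const c i => (B (𝟙_ C)).repr (M.const c) i
  | .scalar i => M.scalar (B (𝟙_ C) i)

lemma Term.lift_coord (a : M.Assignment) {X : C} (t : Term C K X) (i : Fin (d X)) :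
    FreeCommRing.lift (CoordVar.value B a) (t.coord i) = (B X).repr (t.value M a) i := by
  induction t with
  | var X n => simp [coord, CoordVar.value, value]
  | const c => simp [coord, CoordVar.value, value]
  | @map X Y f t ih =>
    simp only [coord, map_sum, map_mul, FreeCommRing.lift_of, ih, CoordVar.value, value]
    conv_rhs => rw [← (B X).sum_repr (t.value M a), Struct.map_eq]
    simp only [Struct.map_eq, map_sum, _root_.map_smul, Finsupp.coe_finsetSum, Finset.sum_apply,
      Finsupp.smul_apply, smul_eq_mul, mul_comm]
  | add s t ihs iht => simp [coord, ihs, iht, value, M.add_eq]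
  | smul s t ihs iht =>
    simp only [coord, map_sum, map_mul, FreeCommRing.lift_of, ihs, iht, CoordVar.value, value,
      M.smul_eq, _root_.map_smul, Finsupp.smul_apply, smul_eq_mul]
    congr 1
    conv_rhs => rw [← (B (𝟙_ C)).sum_repr (s.value M a)]
    simp only [map_sum, _root_.map_smul, smul_eq_mul, mul_comm]
  | @tensor X Y s t ihs iht =>
    simp only [coord, map_sum, map_mul, FreeCommRing.lift_of, ihs, iht, CoordVar.value, value]
    conv_rhs => rw [← (B X).sum_repr (s.value M a), ← (B Y).sum_repr (t.value M a), M.tensor_eq]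
    simp only [map_sum, _root_.map_smul, LinearMap.sum_apply, LinearMap.smul_apply,
      Finsupp.coe_finsetSum, Finset.sum_apply, Finsupp.smul_apply, smul_eq_mul, Finset.mul_sum,
      M.tensor_eq]
    rw [Finset.sum_comm]
    exact Finset.sum_congr rfl fun i _ => Finset.sum_congr rfl fun j _ => by ring

lemma CoordVar.elim_value_split (a : M.Assignment) (X : C) (n : ℕ) (x : M.carrier X) :
    Sum.elim (CoordVar.value B a) ((B X).repr x) ∘ CoordVar.split X n =
      CoordVar.value B (a.update X n x) := by
  funext c
  cases c with
  | var Y m i =>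
    by_cases h : Y = X ∧ m = n
    · obtain ⟨rfl, rfl⟩ := h
      simp [split, value]
    · have : a.update X n x Y m = a Y m := by
        by_cases hY : Y = X
        · exact Struct.Assignment.update_of_ne _ _ _ _ fun hm => h ⟨hY, hm⟩
        · exact Struct.Assignment.update_of_ne_sort _ _ _ _ hY
      simp [split, value, h, this]
  | _ => rfl

/-- A formula holds in a model if and only if its translation holds for the coordinates. -/
lemma Formula.realize_toRing (φ : Formula C K) (a : M.Assignment) :
    (φ.toRing (d := d)).Realize (CoordVar.value B a) ↔ φ.Realize M a := by
  induction φ generalizing a with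
  | falsum => exact Iff.rfl
  | @equal X s t =>
    simp only [toRing, Language.Formula.Realize, Language.BoundedFormula.realize_iInf]
    simp only [← Language.Formula.Realize.eq_1, Language.Formula.realize_equal,
      Ring.realize_termOfFreeCommRing, Term.lift_coord, Realize]
    rw [← (B X).repr.injective.eq_iff, DFunLike.ext_iff]
  | imp φ ψ h₁ h₂ =>
    simp only [toRing, Realize, ← h₁, ← h₂]
    exact Language.BoundedFormula.realize_imp
  | all X n φ ih =>
    simp only [toRing, Realize, Language.Formula.realize_iAlls, Language.Formula.realize_relabel]
    -- The basis identifies a quantifier over `V_X` with one over coordinate tuples.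
    rw [← (B X).equivFun.toEquiv.forall_congr_right]
    refine forall_congr' fun x => ?_
    rw [← ih, ← CoordVar.elim_value_split]
    rfl

open Classical in
/-- Express the coordinates of the first `n` variables of the sort `L` by these variables. -/
def CoordVar.substL (n : ℕ) : CoordVar C K d → Language.ring.Term (CoordVar C K d ⊕ Fin n)
  | .var X m i =>
      if h : X = 𝟙_ C ∧ m < n then
        -- A scalar `y` is the vector `y • 1` of `V_𝟙`, so its coordinates are `y` times those of
        -- the constant `1`.
        .var (.inr ⟨m, h.2⟩) * .var (.inl (.const 1 (i.cast (congrArg d h.1))))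
      else .var (.inl (.var X m i))
  | c => .var (.inl c)

lemma CoordVar.realize_substL (a : M.Assignment) {n : ℕ} (y : Fin n → M.L) (c : CoordVar C K d) :
    (c.substL n).realize (Sum.elim (CoordVar.value B a) y) = c.value B (a.setL y) := by
  cases c with
  | var X m i =>
    by_cases h : X = 𝟙_ C ∧ m < n
    · obtain ⟨rfl, hm⟩ := h
      have : y ⟨m, hm⟩ = y ⟨m, hm⟩ • (M.const 1 : M.carrier (𝟙_ C)) :=
        (mul_one (y ⟨m, hm⟩)).symm
      have hy : a.setL y (𝟙_ C) m = y ⟨m, hm⟩ • (M.const 1 : M.carrier (𝟙_ C)) := by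
        rw [← this]
        exact Struct.Assignment.setL_of_lt a y hm
      simp [substL, value, hm, hy]
    · have : a.setL y X m = a X m := by
        by_cases hX : X = 𝟙_ C
        · subst hX
          exact Struct.Assignment.setL_of_le a y (not_lt.mp fun hm => h ⟨rfl, hm⟩)
        · simp [Struct.Assignment.setL, hX]
      simp [substL, value, h, this]
  | _ => rfl

/-- The trace on `L` of a formula is given by a formula in the language of rings, uniformly in all
models and bases. -/
lemma exists_ringFormula (d : C → ℕ) (φ : Formula C K) (n : ℕ) :
    ∃ (m : ℕ) (ι : Fin m → CoordVar C K d) (ψ : Language.ring.Formula (Fin m ⊕ Fin n)),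
      ∀ (M : Struct.{v, u, r, w} C K) [M.VectorSpaces]
        (B : ∀ X : C, Module.Basis (Fin (d X)) M.L (M.carrier X)) (a : M.Assignment)
        (y : Fin n → M.L), φ.Realize M (a.setL y) ↔
          ψ.Realize (Sum.elim (CoordVar.value B a ∘ ι) y) := by
  obtain ⟨m, ι, ψ, h⟩ := ACFDefinable.exists_restrict_realize.{w}
    (φ.toRing.subst (CoordVar.substL (C := C) (K := K) (d := d) n))
  refine ⟨m, ι, ψ, fun M _ B a y => ?_⟩
  rw [← φ.realize_toRing B, ← h]
  refine Iff.trans ?_ Language.BoundedFormula.realize_subst.symm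
  simp only [CoordVar.realize_substL]
  rfl

end Translation

/-! ### Stable embeddedness of `L` and stability. -/

section StablyEmbedded

variable {k : Type*} [Field k] {C : Type u} [Category.{v} C] [Abelian C] [MonoidalCategory C]
  [SymmetricCategory C] [RigidCategory C] [Linear k C]

/-- The field `L` is stably embedded. -/
theorem stablyEmbedded_theory (hrank : ∀ X : C, ∃ n : ℕ, HasRank X n)
    (K : Type r) [Field K] [Algebra k K] : StablyEmbedded.{v, u, r, w} (theory k C K) := by
  intro φ n
  choose d hd using hrank
  obtain ⟨m, ι, ψ, h⟩ := exists_ringFormula.{v, u, r, w} d φ n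
  refine ⟨m, ψ, fun M hM x => ?_⟩
  have := hM.vectorSpaces
  let B (X : C) := (hM.nonempty_basis (hd X)).some
  exact ⟨_, h M B x⟩

open ACFDefinable MvPolynomial

/-- Each monomial splits into a factor in the coordinates with `Q`, depending on `i`, and a factor
in the others, depending on `j`. The value of `p` is therefore a finite pairing, with one index for
each monomial in the support. -/
lemma eventually_eval_merge_swap {F σ : Type*} [Field F] [Finite σ] (Q : σ → Prop)
    (x y : ℕ → σ → F) (z : ℕ → ℕ → σ → F) (hQ : ∀ i j s, Q s → z i j s = x i s)
    (hQ' : ∀ i j s, ¬ Q s → z i j s = y j s) (p : MvPolynomial σ F) (U : Ultrafilter ℕ) :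
    (∀ᶠ i in U, ∀ᶠ j in U, eval (z i j) p = 0) ↔ ∀ᶠ j in U, ∀ᶠ i in U, eval (z i j) p = 0 := by
  classical
  have := Fintype.ofFinite σ
  have key (i j : ℕ) : eval (z i j) p = ∑ l : p.support,
      (p.coeff l.1 * ∏ s with Q s, x i s ^ l.1 s) * ∏ s with ¬ Q s, y j s ^ l.1 s := by
    rw [eval_eq', ← Finset.sum_coe_sort]
    refine Finset.sum_congr rfl fun l _ => ?_
    rw [mul_assoc, ← Finset.prod_filter_mul_prod_filter_not _ Q]
    congr 2
    · exact Finset.prod_congr rfl fun s hs => by rw [hQ i j s (Finset.mem_filter.mp hs).2]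
    · exact Finset.prod_congr rfl fun s hs => by rw [hQ' i j s (Finset.mem_filter.mp hs).2]
  simp only [key]
  exact eventually_sum_mul_eq_zero_swap_iff U
    (fun i (l : p.support) => p.coeff l.1 * ∏ s with Q s, x i s ^ l.1 s)
    (fun j (l : p.support) => ∏ s with ¬ Q s, y j s ^ l.1 s)

/-- The theory `T_C` is stable. -/
theorem stable_theory (hrank : ∀ X : C, ∃ n : ℕ, HasRank X n)
    (K : Type r) [Field K] [Algebra k K] : Stable.{v, u, r, w} (theory k C K) := by
  intro M hM φ P a b
  choose d hd using hrank
  obtain ⟨m, ι, ψ, h⟩ := exists_ringFormula.{v, u, r, w} d φ 0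
  have := hM.vectorSpaces
  have := hM.isAlgClosed
  let B (X : C) := (hM.nonempty_basis (hd X)).some
  have hψ (c : M.Assignment) :
      φ.Realize M c ↔ ψ.Realize (Sum.elim (CoordVar.value B c ∘ ι) finZeroElim) := by
    rw [← h M B c]
    simp [Struct.Assignment.setL]
  simp only [hψ]
  -- Coordinates of the variables in `P` come from `a i`, those of other variables from `b j`;
  -- structure constants depend on neither and are counted with `a i`.
  let Q : CoordVar C K d → Prop
    | .var X n _ => (X, n) ∈ P
    | _ => True
  refine (finitelyDetermined_realize ψ).not_order
    (fun i j => Sum.elim (CoordVar.value B (Struct.Assignment.merge P (a i) (b j)) ∘ ι)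
      finZeroElim) fun p U => ?_
  refine eventually_eval_merge_swap (Sum.elim (Q ∘ ι) finZeroElim)
    (fun i => Sum.elim (CoordVar.value B (a i) ∘ ι) finZeroElim)
    (fun j => Sum.elim (CoordVar.value B (b j) ∘ ι) finZeroElim) _ ?_ ?_ p U
  · rintro i j (s | s) hs
    · simp only [Sum.elim_inl, Function.comp_apply] at hs ⊢
      generalize ι s = c at hs
      cases c with
      | var X n l =>
        have hs : (X, n) ∈ P := hs
        simp [CoordVar.value, Struct.Assignment.merge, hs]
      | _ => rfl
    · exact s.elim0
  · rintro i j (s | s) hs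
    · simp only [Sum.elim_inl, Function.comp_apply] at hs ⊢
      generalize ι s = c at hs
      cases c with
      | var X n l =>
        have hs : (X, n) ∉ P := hs
        simp [CoordVar.value, Struct.Assignment.merge, hs]
      | _ => exact (hs trivial).elim
    · exact s.elim0

end StablyEmbedded

end TensorTheory

end

noncomputable section

namespace ACFDefinable

open MvPolynomial FirstOrder

/-! ### Fields of definition of Zariski closures, and descent of parameters. -/

section Descent

variable {F : Type*} [Field F] {σ τ : Type*}

lemma FinitelyDetermined.preimage_sumElim {S : Set (τ ⊕ σ → F)} (hS : FinitelyDetermined S)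
    (x : τ → F) : FinitelyDetermined {y : σ → F | Sum.elim x y ∈ S} := by
  obtain ⟨P, hP, h⟩ := hS
  have key (y : σ → F) (p : MvPolynomial (τ ⊕ σ) F) :
      eval y (aeval (Sum.elim (fun i => C (x i)) X : τ ⊕ σ → MvPolynomial σ F) p) =
        eval (Sum.elim x y) p := by
    induction p using MvPolynomial.induction_on with
    | C c => simp
    | add p q hp hq => simp only [map_add, hp, hq]
    | mul_X p i hp => rcases i with i | i <;> simp only [map_mul, hp, aeval_X] <;> simp
  refine ⟨_, hP.image (aeval (Sum.elim (fun i => C (x i)) X : τ ⊕ σ → MvPolynomial σ F)),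
    fun y z hyz => h _ _ fun p hp => ?_⟩
  have := hyz _ (Set.mem_image_of_mem _ hp)
  rwa [key, key] at this

/-- Vanishing patterns are constant on a nonempty relatively open piece of `T`: if `p` is nonzero
somewhere on the current piece, shrink it by multiplying `q` by `p`; otherwise `p` already vanishes
there. -/
lemma exists_eval_ne_zero_forall_iff {T : Set (σ → F)} (hT : T.Nonempty)
    {P : Set (MvPolynomial σ F)} (hP : P.Finite) :
    ∃ q : MvPolynomial σ F, ∃ x ∈ T, eval x q ≠ 0 ∧
      ∀ y ∈ T, eval y q ≠ 0 → ∀ p ∈ P, eval y p = 0 ↔ eval x p = 0 := by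
  induction P, hP using Set.Finite.induction_on with
  | empty =>
    obtain ⟨x, hx⟩ := hT
    exact ⟨1, x, hx, by simp, by simp⟩
  | @insert p P _ _ ih =>
    obtain ⟨q, x, hx, hqx, hq⟩ := ih
    by_cases h : ∃ y ∈ T, eval y q ≠ 0 ∧ eval y p ≠ 0
    · obtain ⟨y, hy, hqy, hpy⟩ := h
      refine ⟨q * p, y, hy, by simp [hqy, hpy], fun z hz hqz => ?_⟩
      rw [map_mul, mul_ne_zero_iff] at hqz
      rintro p' (rfl | hp')
      · simp [hqz.2, hpy]
      · exact (hq z hz hqz.1 p' hp').trans (hq y hy hqy p' hp').symm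
    · push Not at h
      refine ⟨q, x, hx, hqx, fun y hy hqy => ?_⟩
      rintro p' (rfl | hp')
      · simp [h y hy hqy, h x hx hqx]
      · exact hq y hy hqy p' hp'

/-- A finitely determined set and its complement are not both dense in a nonempty set. -/
lemma FinitelyDetermined.vanishingIdeal_ne {S : Set (σ → F)} (hS : FinitelyDetermined S)
    {T : Set (σ → F)} (hT : T.Nonempty) :
    vanishingIdeal F (S ∩ T) ≠ vanishingIdeal F T ∨
      vanishingIdeal F (T \ S) ≠ vanishingIdeal F T := by
  obtain ⟨P, hP, h⟩ := hS
  -- Where `q` is nonzero, `T` lies entirely inside or entirely outside `S`. So `q` vanishes on one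
  -- of `T \ S` and `S ∩ T`, but not on `T`.
  obtain ⟨q, x, hx, hqx, hq⟩ := exists_eval_ne_zero_forall_iff hT hP
  have hqT : q ∉ vanishingIdeal F T := fun hc => hqx (by simpa [aeval_eq_eval] using hc x hx)
  have key (y) (hy : y ∈ T) (hqy : eval y q ≠ 0) : y ∈ S ↔ x ∈ S := h y x (hq y hy hqy)
  by_cases hxS : x ∈ S
  · right
    intro hc
    rw [← hc] at hqT
    refine hqT fun y hy => ?_
    by_contra hqy
    exact hy.2 ((key y hy.1 (by simpa [aeval_eq_eval] using hqy)).mpr hxS)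
  · left
    intro hc
    rw [← hc] at hqT
    refine hqT fun y hy => ?_
    by_contra hqy
    exact hxS ((key y hy.2 (by simpa [aeval_eq_eval] using hqy)).mp hy.1)

/-- A subspace of a coordinate space has a basis in reduced echelon form. -/
lemma exists_echelon_basis {ι : Type*} [Fintype ι] [DecidableEq ι] (W : Submodule F (ι → F)) :
    ∃ (J : Finset ι) (b : J → ι → F), (∀ j, b j ∈ W) ∧
      (∀ j j' : J, b j j' = if j' = j then 1 else 0) ∧
      ∀ x ∈ W, (∀ j ∈ J, x j = 0) → x = 0 := by
  -- The pivots form a minimal set of coordinates that detects zero on `W`. Dropping a pivot `j`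
  -- produces a nonzero vector that vanishes at all the other pivots; rescaled, it is the basis
  -- vector for `j`.
  obtain ⟨J, hJ⟩ := exists_minimal_of_wellFoundedLT
    (fun J : Finset ι => ∀ x ∈ W, (∀ j ∈ J, x j = 0) → x = 0)
    ⟨Finset.univ, fun x _ hx => funext fun j => hx j (Finset.mem_univ j)⟩
  have key (j : J) : ∃ b ∈ W, ∀ j' : J, b j' = if j' = j then 1 else 0 := by
    have h : ¬ ∀ x ∈ W, (∀ i ∈ J.erase j, x i = 0) → x = 0 := fun h =>
      Finset.notMem_erase j.1 J (hJ.2 h (Finset.erase_subset _ _) j.2)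
    push Not at h
    obtain ⟨x, hxW, hx, hx0⟩ := h
    have hxj : x j ≠ 0 := fun hxj => hx0 <| hJ.1 x hxW fun i hi => by
      by_cases hij : i = j
      · rw [hij, hxj]
      · exact hx i (Finset.mem_erase.mpr ⟨hij, hi⟩)
    refine ⟨(x j)⁻¹ • x, W.smul_mem _ hxW, fun j' => ?_⟩
    split_ifs with h
    · simp [h, hxj]
    · simp [hx j' (Finset.mem_erase.mpr ⟨fun hc => h (Subtype.ext hc), j'.2⟩)]
  choose b hbW hb using key
  exact ⟨J, b, hbW, hb, hJ.1⟩

lemma subset_zeroLocus_vanishingIdeal (T : Set (σ → F)) :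
    T ⊆ zeroLocus F (vanishingIdeal F T) := fun x hx _ hp => hp x hx

lemma vanishingIdeal_zeroLocus_vanishingIdeal (T : Set (σ → F)) :
    vanishingIdeal F (zeroLocus F (vanishingIdeal F T)) = vanishingIdeal F T :=
  le_antisymm (vanishingIdeal_anti_mono (subset_zeroLocus_vanishingIdeal T))
    fun p hp _ hx => hx p hp

/-- Descent of definable sets to `A`: if `D` is a class of sets that contains the `A`-definable
sets and is closed under Boolean operations, and the Zariski closures of the sets in `D` are
`A`-definable, then the finitely determined sets in `D` are `A`-definable. -/
lemma FinitelyDetermined.definable [Finite σ] [Ring.CompatibleRing F] {A : Set F}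
    (D : Set (σ → F) → Prop) (hD : ∀ T, A.Definable Language.ring T → D T)
    (hinter : ∀ S T, D S → D T → D (S ∩ T)) (hdiff : ∀ S T, D S → D T → D (T \ S))
    (hclosure : ∀ T, D T → A.Definable Language.ring (zeroLocus F (vanishingIdeal F T)))
    {S : Set (σ → F)} (hSD : D S) (hS : FinitelyDetermined S) :
    A.Definable Language.ring S := by
  -- Noetherian induction over closed `A`-definable sets `T`, with larger ideals handled first; `T =
  -- univ` gives the claim.
  suffices h : ∀ (J : Ideal (MvPolynomial σ F)) (T : Set (σ → F)), vanishingIdeal F T = J →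
      zeroLocus F (vanishingIdeal F T) = T → A.Definable Language.ring T →
      A.Definable Language.ring (S ∩ T) by
    have := h _ Set.univ rfl (Set.eq_univ_of_univ_subset (subset_zeroLocus_vanishingIdeal _))
      Set.definable_univ
    rwa [Set.inter_univ] at this
  intro J
  induction J using WellFoundedGT.induction with
  | ind J ih =>
    rintro T rfl hTc hT
    rcases T.eq_empty_or_nonempty with rfl | hne
    · simp
    have hle (T' : Set (σ → F)) (h : T' ⊆ T) :
        zeroLocus F (vanishingIdeal F T') ⊆ T := by
      conv_rhs => rw [← hTc]
      exact zeroLocus_anti_mono (vanishingIdeal_anti_mono h)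
    have step (T' : Set (σ → F)) (h : T' ⊆ T) (hD' : D T')
        (hlt : vanishingIdeal F T' ≠ vanishingIdeal F T) :
        A.Definable Language.ring (S ∩ zeroLocus F (vanishingIdeal F T')) := by
      refine ih (vanishingIdeal F T') (lt_of_le_of_ne (vanishingIdeal_anti_mono h) hlt.symm) _
        (vanishingIdeal_zeroLocus_vanishingIdeal T') ?_ (hclosure _ hD')
      rw [vanishingIdeal_zeroLocus_vanishingIdeal]
    rcases hS.vanishingIdeal_ne hne with h | h
    · have := step _ Set.inter_subset_right (hinter _ _ hSD (hD _ hT)) h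
      convert this using 1
      refine subset_antisymm (fun x hx => ⟨hx.1, subset_zeroLocus_vanishingIdeal _ hx⟩)
        fun x hx => ⟨hx.1, hle _ Set.inter_subset_right hx.2⟩
    · have hD' := hdiff _ _ hSD (hD _ hT)
      -- If `T'` is the closure of `T \ S`, then `T \ S ⊆ T' ⊆ T`, so `S ∩ T = T \ (T' \ (S ∩ T'))`,
      -- and induction applies to `S ∩ T'`.
      have := hT.sdiff ((hclosure _ hD').sdiff (step _ Set.sdiff_subset hD' h))
      convert this using 1
      ext x
      have h₁ : x ∈ T \ S → x ∈ zeroLocus F (vanishingIdeal F (T \ S)) :=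
        fun hx => subset_zeroLocus_vanishingIdeal _ hx
      simp only [Set.mem_inter_iff, Set.mem_sdiff] at h₁ ⊢
      tauto

/-- The Zariski closure of `T` is definable over `A` if `A` contains the entries of the vectors in
the echelon bases of all spaces of coefficient vectors of polynomials that vanish on `T`. -/
lemma definable_zeroLocus_vanishingIdeal {n : ℕ} [Ring.CompatibleRing F] {A : Set F}
    (T : Set (Fin n → F))
    (hA : ∀ (N : ℕ) (mon : Fin N → Fin n → ℕ) (J : Finset (Fin N)) (b : Fin N → F) (j : Fin N),
      (∀ x : Fin N → F, x = b ↔ (∀ y ∈ T, ∑ l, x l * ∏ i, y i ^ mon l i = 0) ∧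
        ∀ i ∈ J, x i = if i = j then 1 else 0) → ∀ l, b l ∈ A) :
    A.Definable Language.ring (zeroLocus F (vanishingIdeal F T)) := by
  classical
  obtain ⟨s, hs⟩ := (IsNoetherian.noetherian (vanishingIdeal F T))
  -- The polynomials supported on the monomials of a finite generating set form a finite-dimensional
  -- space. `W` is its subspace of polynomials vanishing on `T`, and any basis of `W` generates the
  -- ideal.
  let Mon := s.biUnion support
  let N := Mon.card
  let mon (l : Fin N) : Fin n →₀ ℕ := (Mon.equivFin.symm l).1
  have hmon : Function.Injective mon := Subtype.val_injective.comp Mon.equivFin.symm.injective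
  let poly : (Fin N → F) →ₗ[F] MvPolynomial (Fin n) F :=
    ∑ l, (monomial (mon l)).comp (LinearMap.proj l)
  have hpoly (x : Fin N → F) : poly x = ∑ l, monomial (mon l) (x l) := by simp [poly]
  have heval (x : Fin N → F) (y : Fin n → F) :
      aeval y (poly x) = ∑ l, x l * ∏ i, y i ^ mon l i := by
    simp [hpoly, aeval_eq_eval, eval_monomial, Finsupp.prod_fintype]
  let W : Submodule F (Fin N → F) := ((vanishingIdeal F T).restrictScalars F).comap poly
  have hW (x : Fin N → F) : x ∈ W ↔ ∀ y ∈ T, ∑ l, x l * ∏ i, y i ^ mon l i = 0 := by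
    simp only [← heval]
    exact Iff.rfl
  obtain ⟨J, b, hbW, hb, hJ⟩ := exists_echelon_basis W
  have hbA (j : J) (l : Fin N) : b j l ∈ A := by
    refine hA N (fun l => mon l) J (b j) j (fun x => ⟨?_, fun ⟨h₁, h₂⟩ => ?_⟩) l
    · rintro rfl
      exact ⟨(hW _).mp (hbW j), fun i hi => by simpa [Subtype.ext_iff] using hb j ⟨i, hi⟩⟩
    · rw [← sub_eq_zero]
      refine hJ _ (W.sub_mem ((hW x).mpr h₁) (hbW j)) fun i hi => ?_
      have := hb j ⟨i, hi⟩
      simp only [Subtype.ext_iff] at this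
      simp [h₂ i hi, this]
  have hspan : vanishingIdeal F T =
      Ideal.span (Finset.univ.image fun j => poly (b j) : Finset (MvPolynomial (Fin n) F)) := by
    apply le_antisymm
    · rw [← hs]
      refine Submodule.span_le.mpr fun p hp => ?_
      have hpx : p = poly fun l => p.coeff (mon l) := by
        rw [hpoly]
        have : ∑ l : Fin N, monomial (mon l) (p.coeff (mon l)) =
            ∑ m ∈ Mon, monomial m (p.coeff m) := by
          rw [← Finset.sum_coe_sort Mon]
          exact Mon.equivFin.symm.sum_comp fun m : Mon => monomial m.1 (p.coeff m.1)
        rw [this, ← Finset.sum_subset (Finset.subset_biUnion_of_mem support hp)]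
        · exact p.as_sum
        · intro m _ hm
          simp [notMem_support_iff.mp hm]
      have hxW : (fun l => p.coeff (mon l)) ∈ W := by
        change poly _ ∈ vanishingIdeal F T
        rw [← hpx, ← hs]
        exact Submodule.subset_span hp
      have hx : (fun l => p.coeff (mon l)) = ∑ j : J, p.coeff (mon j) • b j := by
        rw [← sub_eq_zero]
        refine hJ _ (W.sub_mem hxW (W.sum_mem fun j _ => W.smul_mem _ (hbW j))) fun i hi => ?_
        simp only [Pi.sub_apply, Finset.sum_apply, Pi.smul_apply, smul_eq_mul, sub_eq_zero]
        rw [Finset.sum_eq_single ⟨i, hi⟩]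
        · simp [hb ⟨i, hi⟩ ⟨i, hi⟩]
        · intro j _ hj
          simp [hb j ⟨i, hi⟩, hj.symm]
        · simp
      rw [SetLike.mem_coe, hpx, hx, map_sum]
      refine Submodule.sum_mem _ fun j _ => ?_
      rw [map_smul, smul_eq_C_mul]
      exact Ideal.mul_mem_left _ _ (Ideal.subset_span (by simp))
    · refine Ideal.span_le.mpr ?_
      intro p hp
      simp only [Finset.coe_image, Finset.coe_univ, Set.image_univ, Set.mem_range] at hp
      obtain ⟨j, rfl⟩ := hp
      exact hbW j
  rw [hspan]
  refine (Ring.mvPolynomial_zeroLocus_definable _).mono ?_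
  intro c hc
  simp only [Finset.mem_image, Finset.mem_univ, true_and, Set.mem_iUnion] at hc
  obtain ⟨p, ⟨j, rfl⟩, m, hm, rfl⟩ := hc
  have hcoeff : (poly (b j)).coeff m = ∑ l, if mon l = m then b j l else 0 := by
    rw [hpoly]
    simp [coeff_sum, coeff_monomial]
  rw [SetLike.mem_coe, mem_support_iff, hcoeff] at hm
  obtain ⟨l, -, hl⟩ := Finset.exists_ne_zero_of_sum_ne_zero hm
  obtain rfl : mon l = m := by
    by_contra h
    simp [h] at hl
  beta_reduce
  rw [hcoeff]
  simpa [hmon.eq_iff] using hbA j l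

end Descent

end ACFDefinable

namespace TensorTheory

/-! ## Definability in a model without parameters -/

section DefinablePred

variable {C : Type u} [Category.{v} C] [MonoidalCategory C] {K : Type r}
  {M : Struct.{v, u, r, w} C K}

namespace Struct.Assignment

/-- The value of the `i`-th variable of the sort `L`. -/
def valL (a : M.Assignment) (i : ℕ) : M.L := a (𝟙_ C) i

/-- The assignment that gives the values `y 0, …, y (n - 1)` to the variables `N, …, N + n - 1` of
the sort `L`. -/
def setBlockL (a : M.Assignment) (N : ℕ) {n : ℕ} (y : Fin n → M.L) : M.Assignment :=
  a.updateBlock (𝟙_ C) N (n := n) y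

@[simp]
lemma valL_setBlockL_add (a : M.Assignment) (N : ℕ) {n : ℕ} (y : Fin n → M.L) (i : Fin n) :
    valL (setBlockL a N y) (N + i) = y i :=
  updateBlock_add (n := n) a (𝟙_ C) N y i

@[simp]
lemma valL_setBlockL_of_lt (a : M.Assignment) {m N n : ℕ} (y : Fin n → M.L) (h : m < N) :
    valL (setBlockL a N y) m = valL a m :=
  updateBlock_of_lt (n := n) a (𝟙_ C) (𝟙_ C) y h

@[simp]
lemma valL_setBlockL_of_le (a : M.Assignment) {m N n : ℕ} (y : Fin n → M.L) (h : N + n ≤ m) :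
    valL (setBlockL a N y) m = valL a m :=
  updateBlock_of_le (n := n) a (𝟙_ C) (𝟙_ C) y h

@[simp]
lemma valL_setBlockL_zero (a : M.Assignment) {n : ℕ} (y : Fin n → M.L) (i : Fin n) :
    valL (setBlockL a 0 y) i = y i := by
  simpa using valL_setBlockL_add a 0 y i

lemma setL_valL (a : M.Assignment) (n : ℕ) : setL a (fun i : Fin n => valL a i) = a := by
  ext X m
  by_cases hX : X = 𝟙_ C
  · subst hX
    rcases lt_or_ge m n with h | h
    · exact setL_of_lt a _ h
    · exact setL_of_le a _ h
  · simp [setL, hX]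

end Struct.Assignment

open Struct.Assignment

/-- A property of assignments is definable if it is given by a formula. -/
def Struct.DefinablePred (M : Struct.{v, u, r, w} C K) (P : M.Assignment → Prop) : Prop :=
  ∃ φ : Formula C K, ∀ a, P a ↔ φ.Realize M a

/-- A function on assignments that is given by a term of sort `L`. -/
def Struct.TermFunction (M : Struct.{v, u, r, w} C K) (f : M.Assignment → M.L) : Prop :=
  ∃ t : Term C K (𝟙_ C), ∀ a, f a = t.value M a

lemma definableL_iff [Field K] {n : ℕ} {S : Set (Fin n → M.L)} :
    M.DefinableL S ↔ M.DefinablePred fun a => (fun i : Fin n => valL a i) ∈ S := by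
  refine exists_congr fun φ => ⟨fun h a => ?_, fun h a y => ?_⟩
  · beta_reduce
    rw [h a, setL_valL]
  · rw [← h, setL_eq_updateBlock]
    exact iff_of_eq (congrArg (· ∈ S) (funext fun i => (valL_setBlockL_zero a y i).symm))

namespace Struct.DefinablePred

variable {P Q : M.Assignment → Prop}

lemma not (hP : M.DefinablePred P) : M.DefinablePred fun a => ¬ P a := by
  obtain ⟨φ, hφ⟩ := hP
  exact ⟨φ.neg, fun a => not_congr (hφ a)⟩

lemma imp (hP : M.DefinablePred P) (hQ : M.DefinablePred Q) :
    M.DefinablePred fun a => P a → Q a := by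
  obtain ⟨φ, hφ⟩ := hP
  obtain ⟨ψ, hψ⟩ := hQ
  exact ⟨φ.imp ψ, fun a => imp_congr (hφ a) (hψ a)⟩

lemma and (hP : M.DefinablePred P) (hQ : M.DefinablePred Q) :
    M.DefinablePred fun a => P a ∧ Q a := by
  obtain ⟨φ, hφ⟩ := hP
  obtain ⟨ψ, hψ⟩ := hQ
  exact ⟨φ.and ψ, fun a => (and_congr (hφ a) (hψ a)).trans (Formula.realize_and φ ψ).symm⟩

lemma const (p : Prop) : M.DefinablePred fun _ => p := by
  by_cases hp : p
  · exact ⟨.verum, fun a => iff_of_true hp Formula.realize_verum⟩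
  · exact ⟨.falsum, fun a => iff_of_false hp id⟩

lemma forall_fin {n : ℕ} {P : Fin n → M.Assignment → Prop} (hP : ∀ i, M.DefinablePred (P i)) :
    M.DefinablePred fun a => ∀ i, P i a := by
  choose φ hφ using hP
  exact ⟨Formula.conj (List.ofFn φ), fun a => by simp [Formula.realize_conj, hφ]⟩

lemma forall_setBlockL (hP : M.DefinablePred P) (N n : ℕ) :
    M.DefinablePred fun a => ∀ y : Fin n → M.L, P (setBlockL a N y) := by
  obtain ⟨φ, hφ⟩ := hP
  exact ⟨.allBlock (𝟙_ C) N n φ, fun a => by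
    rw [Formula.realize_allBlock]; exact forall_congr' fun y => hφ _⟩

lemma exists_setBlockL (hP : M.DefinablePred P) (N n : ℕ) :
    M.DefinablePred fun a => ∃ y : Fin n → M.L, P (setBlockL a N y) := by
  simpa using (hP.not.forall_setBlockL N n).not

lemma eq {f g : M.Assignment → M.L} (hf : M.TermFunction f) (hg : M.TermFunction g) :
    M.DefinablePred fun a => f a = g a := by
  obtain ⟨s, hs⟩ := hf
  obtain ⟨t, ht⟩ := hg
  exact ⟨.equal s t, fun a => by beta_reduce; rw [hs, ht]; rfl⟩

end Struct.DefinablePred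

namespace Struct.TermFunction

lemma valL (i : ℕ) : M.TermFunction fun a => valL a i := ⟨.var _ i, fun _ => rfl⟩

lemma const (c : K) : M.TermFunction fun _ => M.const c := ⟨.const c, fun _ => rfl⟩

variable {f g : M.Assignment → M.L}

lemma add (hf : M.TermFunction f) (hg : M.TermFunction g) :
    M.TermFunction fun a => f a + g a := by
  obtain ⟨s, hs⟩ := hf
  obtain ⟨t, ht⟩ := hg
  exact ⟨.add s t, fun a => by beta_reduce; rw [hs, ht]; rfl⟩

lemma mul (hf : M.TermFunction f) (hg : M.TermFunction g) :
    M.TermFunction fun a => f a * g a := by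
  obtain ⟨s, hs⟩ := hf
  obtain ⟨t, ht⟩ := hg
  exact ⟨.smul s t, fun a => by beta_reduce; rw [hs, ht]; rfl⟩

lemma zero [Field K] : M.TermFunction fun _ => 0 := const 0

lemma one [Field K] : M.TermFunction fun _ => 1 := const 1

open FirstOrder in
lemma realize [Field K] {α : Type*} (t : Language.ring.Term α) {f : α → M.Assignment → M.L}
    (hf : ∀ i, M.TermFunction (f i)) : M.TermFunction fun a => t.realize fun i => f i a := by
  induction t with
  | var i => exact hf i
  | func g ts ih =>
    cases g with
    | add => exact (ih 0).add (ih 1)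
    | mul => exact (ih 0).mul (ih 1)
    | neg => exact (const (-1)).mul (ih 0)
    | zero => exact zero
    | one => exact one

variable [Field K] [M.VectorSpaces]

lemma pow (hf : M.TermFunction f) (n : ℕ) : M.TermFunction fun a => f a ^ n := by
  induction n with
  | zero => simpa using one
  | succ n ih => simpa only [pow_succ] using ih.mul hf

lemma sum {n : ℕ} {f : Fin n → M.Assignment → M.L} (hf : ∀ i, M.TermFunction (f i)) :
    M.TermFunction fun a => ∑ i, f i a := by
  induction n with
  | zero => simpa using zero
  | succ n ih =>
    simp only [Fin.sum_univ_succ]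
    exact (hf 0).add (ih fun i => hf i.succ)

lemma prod {n : ℕ} {f : Fin n → M.Assignment → M.L} (hf : ∀ i, M.TermFunction (f i)) :
    M.TermFunction fun a => ∏ i, f i a := by
  induction n with
  | zero => simpa using one
  | succ n ih =>
    simp only [Fin.prod_univ_succ]
    exact (hf 0).mul (ih fun i => hf i.succ)

end Struct.TermFunction

variable (M) in
/-- The elements of `L` that are definable in `M` without parameters. -/
def Struct.definableElements : Set M.L := {c | M.DefinablePred fun a => valL a 0 = c}

lemma const_mem_definableElements (c : K) : M.const c ∈ M.definableElements :=
  .eq (.valL 0) (.const c)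

lemma definablePred_valL_eq {c : M.L} (hc : c ∈ M.definableElements) (i : ℕ) :
    M.DefinablePred fun a => valL a i = c := by
  rcases Nat.eq_zero_or_pos i with rfl | hi
  · exact hc
  -- The definition of `c` speaks about variable `0`, so it is moved to variable `i` by quantifying
  -- over variable `0` subject to its equality with variable `i`.
  · have := ((Struct.DefinablePred.eq (.valL 0) (.valL i)).imp hc).forall_setBlockL 0 1
    convert this using 2 with a
    have key (y : Fin 1 → M.L) : valL (setBlockL a 0 y) 0 = y 0 := valL_setBlockL_zero a y 0
    have key' (y : Fin 1 → M.L) : valL (setBlockL a 0 y) i = valL a i :=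
      valL_setBlockL_of_le a y (by omega)
    simp only [key, key']
    exact ⟨fun h y hy => hy.trans h, fun h => h (fun _ => valL a i) rfl⟩

open FirstOrder

variable [Field K]

/-- The bound variables are placed in the slots from `N` on, clear of the slots `ρ i` of the free
variables. -/
lemma definablePred_realize {α : Type*} {n : ℕ} (φ : Language.ring.BoundedFormula α n)
    (ρ : α → ℕ) (N : ℕ) (hρ : ∀ i, ρ i < N) :
    M.DefinablePred fun a => φ.Realize (fun i => valL a (ρ i)) fun j => valL a (N + j) := by
  induction φ with
  | falsum => exact .const False
  | @equal n s t =>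
    have key (s : Language.ring.Term (α ⊕ Fin n)) := Struct.TermFunction.realize (M := M) s
      (f := fun i a => Sum.elim (fun i => valL a (ρ i)) (fun j : Fin n => valL a (N + j)) i) (by
        rintro (i | j)
        · exact .valL _
        · exact .valL _)
    exact .eq (key s) (key t)
  | rel R => nomatch R
  | imp φ ψ h₁ h₂ => exact h₁.imp h₂
  | @all n φ ih =>
    have := ih.forall_setBlockL (N + n) 1
    convert this using 2 with a
    rw [Language.BoundedFormula.realize_all,
      ← (Equiv.funUnique (Fin 1) M.L).forall_congr_right]
    refine forall_congr' fun y => iff_of_eq ?_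
    congr 1
    · funext i
      rw [valL_setBlockL_of_lt _ _ ((hρ i).trans_le (Nat.le_add_right _ _))]
    · funext j
      refine Fin.lastCases ?_ (fun j => ?_) j
      · simpa using (valL_setBlockL_add a (N + n) y 0).symm
      · rw [Fin.snoc_castSucc, valL_setBlockL_of_lt _ _ (by simp)]
        rfl

lemma definableL_of_definable {n : ℕ} {S : Set (Fin n → M.L)}
    (hS : M.definableElements.Definable Language.ring S) : M.DefinableL S := by
  obtain ⟨χ, rfl⟩ := Set.definable_iff_exists_formula_sum.mp hS
  obtain ⟨m, ι, ψ, hψ⟩ := ACFDefinable.exists_restrict_realize.{w} χ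
  rw [definableL_iff]
  let ρ : Fin m ⊕ Fin n → ℕ := Sum.elim (fun j => n + j) fun i => i
  have h₁ : M.DefinablePred fun a => ψ.Realize fun s => valL a (ρ s) := by
    have := definablePred_realize (M := M) ψ ρ (n + m) (by
      rintro (j | i) <;> simp only [ρ, Sum.elim_inl, Sum.elim_inr] <;> omega)
    convert this using 2 with a
    unfold Language.Formula.Realize
    exact iff_of_eq (congrArg _ (Subsingleton.elim _ _))
  have h₂ : M.DefinablePred fun a => ∀ j : Fin m, valL a (n + j) = (ι j).1 :=
    .forall_fin fun j => definablePred_valL_eq (ι j).2 _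
  -- The parameters are replaced by universally quantified variables in the slots from `n` on, each
  -- pinned down by its definition.
  convert (h₂.imp h₁).forall_setBlockL n m using 2 with a
  simp only [valL_setBlockL_add]
  have key (y : Fin m → M.L) : (fun s => valL (setBlockL a n y) (ρ s)) =
      Sum.elim y fun i : Fin n => valL a i := by
    funext s
    rcases s with j | i
    · exact valL_setBlockL_add a n y j
    · exact valL_setBlockL_of_lt a y i.2
  simp only [key, ← funext_iff, Set.mem_ofPred_eq]
  rw [forall_eq, hψ]
  rfl

/-- An echelon basis vector is the only one satisfying its defining conditions, so each of its
entries is definable by quantifying over the whole vector. -/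
lemma definable_closure [M.VectorSpaces] {n : ℕ} {T : Set (Fin n → M.L)} (hT : M.DefinableL T) :
    M.definableElements.Definable Language.ring
      (MvPolynomial.zeroLocus M.L (MvPolynomial.vanishingIdeal M.L T)) := by
  refine ACFDefinable.definable_zeroLocus_vanishingIdeal T fun N mon J b j hb l => ?_
  rw [definableL_iff] at hT
  have h₁ := (hT.imp (.eq (.sum fun l : Fin N => (Struct.TermFunction.valL (n + 1 + l)).mul
    (.prod fun i : Fin n => (Struct.TermFunction.valL i).pow (mon l i))) .zero)).forall_setBlockL
      0 n
  have h₂ : M.DefinablePred fun a => ∀ i : Fin N, i ∈ J →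
      valL a (n + 1 + i) = if i = j then 1 else 0 :=
    .forall_fin fun i => (Struct.DefinablePred.const _).imp
      (.eq (.valL _) (by split_ifs; exacts [.one, .zero]))
  have h₃ : M.DefinablePred fun a => valL a 0 = valL a (n + 1 + l) := .eq (.valL _) (.valL _)
  -- Slot `0` holds the candidate entry, and the points of `T` use slots `0` to `n - 1` only inside
  -- `h₁`. The vector starts at slot `n + 1`, so as to avoid slot `0` even when `n = 0`.
  have := ((h₁.and h₂).and h₃).exists_setBlockL (n + 1) N
  change M.DefinablePred _
  convert this using 2 with a
  have key (x : Fin N → M.L) (y : Fin n → M.L) (l : Fin N) :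
      valL (setBlockL (setBlockL a (n + 1) x) 0 y) (n + 1 + l) = x l := by
    rw [valL_setBlockL_of_le _ _ (by omega), valL_setBlockL_add]
  have key' (x : Fin N → M.L) : valL (setBlockL a (n + 1) x) 0 = valL a 0 :=
    valL_setBlockL_of_lt _ _ (by omega)
  simp only [key, key', valL_setBlockL_zero, valL_setBlockL_add]
  constructor
  · intro h
    exact ⟨b, (hb b).mp rfl, h⟩
  · rintro ⟨x, hx, h⟩
    rw [h, (hb x).mpr hx]

end DefinablePred

/-! ### Purity of the field `L`. -/

section Pure

variable {k : Type*} [Field k] [CharZero k] {C : Type u} [Category.{v} C] [Abelian C]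
  [MonoidalCategory C] [SymmetricCategory C] [RigidCategory C] [Linear k C] {K : Type r} [Field K]
  [Algebra k K] {M : Struct.{v, u, r, w} C K}

open FirstOrder Struct.Assignment

/-- The field `L` is a pure algebraically closed field with additional constants. -/
theorem isPureACF_of_models (hrank : ∀ X : C, ∃ n : ℕ, HasRank X n)
    (hM : M.Models (theory k C K)) : M.IsPureACF := by
  have := hM.vectorSpaces
  have := hM.isAlgClosed
  have : CharZero M.L :=
    charZero_of_injective_ringHom (M.constHom.comp (algebraMap k K)).injective
  refine ⟨inferInstanceAs ((Language.Theory.ACF 0).Model M.L), M.definableElements,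
    const_mem_definableElements, fun n S => ⟨fun hS => ?_, definableL_of_definable⟩⟩
  refine ACFDefinable.FinitelyDetermined.definable (fun T => M.DefinableL T)
    (fun T hT => definableL_of_definable hT) (fun S T hS hT => ?_) (fun S T hS hT => ?_)
    (fun T hT => definable_closure hT) hS ?_
  · rw [definableL_iff] at *
    exact hS.and hT
  · rw [definableL_iff] at *
    exact hT.and hS.not
  · obtain ⟨φ, hφ⟩ := hS
    -- Stable embeddedness gives a definition of `S` with arbitrary parameters from `L`, which is
    -- enough for `S` to be finitely determined.
    obtain ⟨m, ψ, hψ⟩ := stablyEmbedded_theory.{v, u, r, w} (k := k) hrank K φ n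
    obtain ⟨x, hx⟩ := hψ M hM M.someAssignment
    convert (ACFDefinable.finitelyDetermined_realize ψ).preimage_sumElim x using 1
    ext y
    rw [hφ M.someAssignment, hx]
    rfl

end Pure

end TensorTheory

end

theorem mainTheorem8 {k : Type*} [Field k] [CharZero k]
    {C : Type u} [Category.{v} C] [Abelian C] [MonoidalCategory C] [SymmetricCategory C]
    [RigidCategory C] [MonoidalPreadditive C] [Linear k C] [MonoidalLinear k C]
    (hEnd : Function.Bijective fun a : k => a • 𝟙 (𝟙_ C))
    (hrank : ∀ X : C, ∃ n : ℕ, TensorTheory.HasRank X n)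
    (K : Type r) [Field K] [Algebra k K] :
    TensorTheory.Stable.{v, u, r, w} (TensorTheory.theory k C K) ∧
    TensorTheory.StablyEmbedded.{v, u, r, w} (TensorTheory.theory k C K) ∧
    ∀ M : TensorTheory.Struct.{v, u, r, w} C K, M.Models (TensorTheory.theory k C K) →
      M.IsPureACF := by
  refine ⟨TensorTheory.stable_theory hrank K, TensorTheory.stablyEmbedded_theory hrank K,
    fun M hM => TensorTheory.isPureACF_of_models hrank hM⟩
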